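/- Let $n,l\ge 0$ be integers, let $m\in\{2l,2l+1\}$, and let $X_1,\ldots,X_n$ and $w$ be elements of a field (for instance, indeterminates over $\mathbb{Q}$) such that $X_i\neq 0,1$ for all $i$, and $X_i\ne X_j$, $X_iX_j\neq 1$ for all $i<j$. Put $$ R_m=\prod_{i=1}^{n} (X_i^{-1} + 1+w + X_i)\; \frac{\det_{1 \le i, j \le n} \left( X_i^{j-1} (1+X_i)^{j-1} (1+ w X_i)^{n-j} - X_i^{m+2n-j} (1+X_i^{-1})^{j-1} (1+w X_i^{-1})^{n-j} \right)}{\prod_{i=1}^n (1-X_i) \prod_{1 \le i < j \le n} (1-X_i X_j)(X_j-X_i)} . $$ *Families of paths.* For $i,j\in\{1,\ldots,n\}$ let $A_i=\{(-3i+1,-i+1),(-i+1,-3i+1)\}$ and let $$E_j=\{(n-j+l+1,j-l-2)\},\quad E'_j=\{(n-j+l+1,2j-n-l-2)\}\qquad\text{if } m=2l+1,$$ $$E_j=\{(n-j+l+1,j-l-2),(n-j+l,j-l-1)\},\quad E'_j=\{(n-j+l+1,2j-n-l-2),(n-j+l,2j-n-l-1)\}\qquad\text{if } m=2l .$$ A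 family of $n$ lattice paths from the $A_i$ to the $E_j$ consists of a permutation $\sigma$ of $\{1,\ldots,n\}$ and, for each $i$, a lattice path from one of the two points of $A_i$ to a point of $E_{\sigma(i)}$, with the following steps. On and below the line $x+y=0$ (both ends of the step satisfy $x+y\le 0$) the step set is $\{(1,1),(-1,1)\}$ if the path starts in $(-3i+1,-i+1)$, and $\{(1,1),(1,-1)\}$ if it starts in $(-i+1,-3i+1)$. Above this line (both ends satisfy $x+y\ge 0$) the step set is $\{(1,0),(0,1)\}$. Families from the $A_i$ to the $E'_j$ are defined in the same way. *Weight.* A step $(-1,1)$ or $(1,-1)$ on the diagonal $x+y=-2d$ (that is, at distance $d$ from $x+y=0$) has weight $X_{d/2+1}$ if $d$ is even and $X_{(d+1)/2}^{-1}$ if $d$ is odd. On a path that ends in $E_j$ (or $E'_j$), the horizontal steps above the line $x+y=j-1$ (that is, starting at a point with $x+y\ge j-1$) have weight $w$. All other steps have weight $1$. The weight of a family is the product of the weights of all steps of its paths. *Sign.* The sign of a family is $\operatorname{sgn}\sigma$ times $-1$ for each $i$ for which $(-i+1,-3i+1)$ is chosen from $A_i$. Let $I$ be the set of those $i$ for which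 $(-3i+1,-i+1)$ is chosen from $A_i$. *Overall factor.* Let $$C_{2l+1}=\prod_{i=1}^{n} X_i^{l} (X_i^{-1}+1+w + X_i)(1+X_i),\qquad C_{2l}=\prod_{i=1}^{n} X_i^{l} (X_i^{-1}+1+w + X_i).$$ Then, for $m=2l+1$ and for $m=2l$, the following holds. 1. $R_m=(-1)^{\binom{n+1}{2}}\, C_m \sum \mathrm{sign}\cdot\mathrm{weight}$, where the sum is over all families of $n$ lattice paths from the $A_i$ to the $E_j$. The same is true if the sum is restricted to families in which no two paths share a point below the line $x+y=0$, or to families in which no two paths share a point on or below this line. 2. If $w=1$, the identity in 1 also holds if the sum is restricted to non-intersecting families (no two paths share a point). 3. If $w=0$, the identities in 1 remain true if all $E_j$ are replaced by $E'_j$, and then the sum may also be restricted to non-intersecting families. 4. For every non-intersecting family from the $A_i$ to the $E_j$, or from the $A_i$ to the $E'_j$, we have $(-1)^{\binom{n+1}{2}}\cdot\mathrm{sign}=(-1)^{\sum_{i\in I} i}$. Consequently, $R_m= C_m\sum (-1)^{\sum_{i\in I} i}\cdot \mathrm{weight}$, where the sum is over the non-intersecting families, with endpoints $E_j$ if $w=1$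 and with endpoints $E'_j$ if $w=0$. -/

import Mathlib

namespace LittlewoodPaths

/-! Points of the plane are pairs `(x, y)` of integers.  The indices `i`, `j` run over `1, …, n`;
they are stored as elements `i`, `j` of `Fin n`, standing for `i + 1`, `j + 1`. -/

/-- The two starting points in `A_i` (`i ≥ 1`): `true` stands for `(-3i+1, -i+1)` and
`false` stands for `(-i+1, -3i+1)`. -/
def startPoint (first : Bool) (i : ℕ) : ℤ × ℤ :=
  if first then (-3 * (i : ℤ) + 1, -(i : ℤ) + 1) else (-(i : ℤ) + 1, -3 * (i : ℤ) + 1)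

/-- The steps `P → Q` that are allowed for a path starting in the point of `A_i` given by `first`:
on and below the line `x + y = 0` the steps `(1, 1)` and `(-1, 1)` (first point) or `(1, 1)` and
`(1, -1)` (second point); on and above that line the steps `(1, 0)` and `(0, 1)`.  A step belongs
to one of the two regions when both its ends lie there. -/
def IsStep (first : Bool) (P Q : ℤ × ℤ) : Prop :=
  (P.1 + P.2 ≤ 0 ∧ Q.1 + Q.2 ≤ 0 ∧
      (Q = P + (1, 1) ∨ Q = P + if first then (-1, 1) else (1, -1))) ∨
    (0 ≤ P.1 + P.2 ∧ (Q = P + (1, 0) ∨ Q = P + (0, 1)))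

/-- `p` is the list of the successive points of a lattice path from `s` to `e`. -/
def IsLatticePath (first : Bool) (s e : ℤ × ℤ) (p : List (ℤ × ℤ)) : Prop :=
  p.head? = some s ∧ p.getLast? = some e ∧ p.IsChain (IsStep first)

/-- A family of `n` lattice paths: the `i`-th path starts in the point of `A_i` selected by
`start i` and ends in a point of `E (σ i)`, for a permutation `σ`. -/
@[ext] structure PathFamily (n : ℕ) (E : ℕ → Finset (ℤ × ℤ)) where
  perm : Equiv.Perm (Fin n)
  start : Fin n → Bool
  path : Fin n → List (ℤ × ℤ)
  isPath : ∀ i : Fin n, ∃ e ∈ E ((perm i : ℕ) + 1),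
    IsLatticePath (start i) (startPoint (start i) ((i : ℕ) + 1)) e (path i)

/-! ### There are finitely many families -/

/-- A linear function that increases along all steps. -/
def potential (first : Bool) (P : ℤ × ℤ) : ℤ := if first then P.1 + 3 * P.2 else 3 * P.1 + P.2

theorem IsStep.potential_lt {c : Bool} {P Q : ℤ × ℤ} (h : IsStep c P Q) :
    potential c P < potential c Q := by
  obtain ⟨a, b⟩ := P
  cases c <;> rcases h with ⟨-, -, h | h⟩ | ⟨-, h | h⟩ <;> subst h <;> simp [potential] <;> omega

theorem IsLatticePath.cons_cons {c : Bool} {s e a b : ℤ × ℤ} {t : List (ℤ × ℤ)}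
    (h : IsLatticePath c s e (a :: b :: t)) :
    a = s ∧ IsStep c s b ∧ IsLatticePath c b e (b :: t) := by
  obtain ⟨h1, h2, h3⟩ := h
  simp only [List.head?_cons, Option.some.injEq] at h1
  rw [List.isChain_cons_cons] at h3
  subst h1
  exact ⟨rfl, h3.1, rfl, by simpa using h2, h3.2⟩

theorem IsLatticePath.potential_le {c : Bool} {e : ℤ × ℤ} :
    ∀ {p : List (ℤ × ℤ)} {s : ℤ × ℤ}, IsLatticePath c s e p → potential c s ≤ potential c e
  | [], _, h => by simp [IsLatticePath] at h
  | [a], s, h => by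
    have h1 : a = s := by simpa using h.1
    have h2 : a = e := by simpa using h.2.1
    rw [← h1, h2]
  | a :: b :: t, s, h => by
    obtain ⟨-, h2, h3⟩ := h.cons_cons
    have := h3.potential_le
    have := h2.potential_lt
    omega

theorem finite_setOf_isLatticePath_aux (c : Bool) (e : ℤ × ℤ) (k : ℕ) :
    ∀ s : ℤ × ℤ, potential c e < potential c s + k → {p | IsLatticePath c s e p}.Finite := by
  induction k with
  | zero =>
    intro s hs
    refine Set.Finite.subset Set.finite_empty fun p hp => ?_
    have := IsLatticePath.potential_le hp
    push_cast at hs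
    omega
  | succ k ih =>
    intro s hs
    have hsucc : {b | IsStep c s b}.Finite := by
      refine Set.Finite.subset (Set.toFinite
        {s + (1, 1), s + (if c then (-1, 1) else (1, -1)), s + (1, 0), s + (0, 1)}) fun b hb => ?_
      rcases hb with ⟨-, -, h | h⟩ | ⟨-, h | h⟩ <;> simp [h]
    have hU : (⋃ b ∈ {b | IsStep c s b}, (List.cons s) '' {p | IsLatticePath c b e p}).Finite := by
      refine hsucc.biUnion fun b hb => ((ih b ?_).image _)
      have := IsStep.potential_lt hb
      push_cast at hs
      omega
    refine Set.Finite.subset (hU.union (Set.finite_singleton [s])) fun p hp => ?_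
    match p, hp with
    | [], hp => simp [IsLatticePath] at hp
    | [a], hp =>
      right
      have h1 : a = s := by simpa using hp.1
      simp [h1]
    | a :: b :: t, hp =>
      left
      obtain ⟨rfl, h2, h3⟩ := hp.cons_cons
      exact Set.mem_biUnion (show b ∈ {b | IsStep c a b} from h2) ⟨b :: t, h3, rfl⟩

theorem finite_setOf_isLatticePath (c : Bool) (s e : ℤ × ℤ) :
    {p | IsLatticePath c s e p}.Finite :=
  finite_setOf_isLatticePath_aux c e ((potential c e - potential c s).toNat + 1) s (by
    push_cast
    have := Int.self_le_toNat (potential c e - potential c s)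
    omega)

instance (n : ℕ) (E : ℕ → Finset (ℤ × ℤ)) : Finite (PathFamily n E) := by
  have hS : (⋃ c : Bool, ⋃ i : Fin n, ⋃ j : Fin n, ⋃ e ∈ (E ((j : ℕ) + 1) : Set (ℤ × ℤ)),
      {p | IsLatticePath c (startPoint c ((i : ℕ) + 1)) e p}).Finite := by
    refine Set.finite_iUnion fun c => Set.finite_iUnion fun i => Set.finite_iUnion fun j => ?_
    exact (Finset.finite_toSet _).biUnion fun e _ => finite_setOf_isLatticePath _ _ _
  have := hS.to_subtype
  refine Finite.of_injective (fun F : PathFamily n E =>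
    (F.perm, F.start, fun i : Fin n => (⟨F.path i, ?_⟩ : {p // p ∈
      (⋃ c : Bool, ⋃ i : Fin n, ⋃ j : Fin n, ⋃ e ∈ (E ((j : ℕ) + 1) : Set (ℤ × ℤ)),
      {p | IsLatticePath c (startPoint c ((i : ℕ) + 1)) e p})}))) ?_
  · obtain ⟨e, he, h⟩ := F.isPath i
    simp only [Set.mem_iUnion]
    exact ⟨F.start i, i, F.perm i, e, he, h⟩
  · intro F G h
    simp only [Prod.mk.injEq] at h
    refine PathFamily.ext h.1 h.2.1 (funext fun i => ?_)
    exact congrArg Subtype.val (congrFun h.2.2 i)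

noncomputable instance (n : ℕ) (E : ℕ → Finset (ℤ × ℤ)) : Fintype (PathFamily n E) :=
  Fintype.ofFinite _

/-! ### Weights and signs -/

section Weights

variable {K : Type*} [Field K] {n : ℕ}

/-- The weight of a step of type `(-1, 1)` or `(1, -1)` at distance `d` from `x + y = 0`, where
`d = 0, 1, 2, …` counts the diagonals: `X_1, X_1⁻¹, X_2, X_2⁻¹, …` for `d = 0, 1, 2, 3, …`.
(The value for `d ≥ 2 n` is irrelevant, as all paths have distance at most `2 n - 1`.) -/
def diagonalWeight (X : Fin n → K) (d : ℕ) : K :=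
  if h : d / 2 < n then (if d % 2 = 0 then X ⟨d / 2, h⟩ else (X ⟨d / 2, h⟩)⁻¹) else 1

/-- The weight of the step `P → Q` of a path that ends in `E_j`, `j ≥ 1`.  The point `P` lies on
the diagonal `x + y = -2 d` at distance `d`; steps `(-1, 1)` and `(1, -1)` are those that stay on
a diagonal.  Horizontal steps above the line `x + y = j - 1` have weight `w`. -/
def stepWeight (X : Fin n → K) (w : K) (j : ℕ) (P Q : ℤ × ℤ) : K :=
  if Q.1 + Q.2 = P.1 + P.2 then diagonalWeight X (-(P.1 + P.2) / 2).toNat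
  else if Q = P + (1, 0) ∧ (j : ℤ) - 1 ≤ P.1 + P.2 then w
  else 1

/-- The weight of a path that ends in `E_j`: the product of the weights of its steps. -/
def pathWeight (X : Fin n → K) (w : K) (j : ℕ) (p : List (ℤ × ℤ)) : K :=
  (List.zipWith (stepWeight X w j) p p.tail).prod

namespace PathFamily

variable {E : ℕ → Finset (ℤ × ℤ)}

/-- The weight of a family: the product of the weights of its paths. -/
def weight (X : Fin n → K) (w : K) (F : PathFamily n E) : K :=
  ∏ i, pathWeight X w ((F.perm i : ℕ) + 1) (F.path i)

/-- The sign of a family: the sign of `σ`, times `-1` for each choice of `(-i+1, -3i+1)`. -/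
def sign (F : PathFamily n E) : ℤ :=
  (Equiv.Perm.sign F.perm : ℤ) * ∏ i, if F.start i then 1 else -1

/-- The sign `(-1)^(i₁ + … + iₘ)`, where `i₁, …, iₘ` are the indices for which `(-3i+1, -i+1)`
is chosen from `A_i`. -/
def indexSign (F : PathFamily n E) : ℤ :=
  (-1) ^ ∑ i, if F.start i then (i : ℕ) + 1 else 0

/-- No two paths of the family have a point in common. -/
def NonIntersecting (F : PathFamily n E) : Prop :=
  ∀ i j, i ≠ j → ∀ P, P ∈ F.path i → P ∉ F.path j

/-- No two paths have a point on or below the line `x + y = 0` in common. -/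
def NonIntersectingOnBelow (F : PathFamily n E) : Prop :=
  ∀ i j, i ≠ j → ∀ P, P.1 + P.2 ≤ 0 → P ∈ F.path i → P ∉ F.path j

/-- No two paths have a point strictly below the line `x + y = 0` in common. -/
def NonIntersectingBelow (F : PathFamily n E) : Prop :=
  ∀ i j, i ≠ j → ∀ P, P.1 + P.2 < 0 → P ∈ F.path i → P ∉ F.path j

end PathFamily

open Classical in
/-- The signed, weighted count of the families of paths with property `good`, with respect to the
sign `sgn`. -/
noncomputable def pathCount (E : ℕ → Finset (ℤ × ℤ)) (X : Fin n → K) (w : K)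
    (sgn : PathFamily n E → ℤ) (good : PathFamily n E → Prop) : K :=
  ∑ F : PathFamily n E with good F, (sgn F : K) * F.weight X w

/-! ### Endpoints and the algebraic expressions -/

/-- `E_j` for `m = 2 l + 1`. -/
def oddEnds (n l j : ℕ) : Finset (ℤ × ℤ) := {((n : ℤ) - j + l + 1, (j : ℤ) - l - 2)}

/-- `E'_j` for `m = 2 l + 1`. -/
def oddEnds' (n l j : ℕ) : Finset (ℤ × ℤ) := {((n : ℤ) - j + l + 1, 2 * (j : ℤ) - n - l - 2)}

/-- `E_j` for `m = 2 l`. -/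
def evenEnds (n l j : ℕ) : Finset (ℤ × ℤ) :=
  {((n : ℤ) - j + l + 1, (j : ℤ) - l - 2), ((n : ℤ) - j + l, (j : ℤ) - l - 1)}

/-- `E'_j` for `m = 2 l`. -/
def evenEnds' (n l j : ℕ) : Finset (ℤ × ℤ) :=
  {((n : ℤ) - j + l + 1, 2 * (j : ℤ) - n - l - 2), ((n : ℤ) - j + l, 2 * (j : ℤ) - n - l - 1)}

/-- The right-hand side of the bounded Littlewood-type identity.  In the matrix, `j : Fin n`
stands for the column `j + 1`; the truncated subtractions are exact as `j + 1 ≤ n`. -/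
noncomputable def boundedRHS (m : ℕ) (X : Fin n → K) (w : K) : K :=
  (∏ i, ((X i)⁻¹ + 1 + w + X i)) *
    (Matrix.det (Matrix.of fun i j : Fin n =>
        X i ^ (j : ℕ) * (1 + X i) ^ (j : ℕ) * (1 + w * X i) ^ (n - (j + 1))
          - X i ^ (m + 2 * n - (j + 1)) * (1 + (X i)⁻¹) ^ (j : ℕ)
            * (1 + w * (X i)⁻¹) ^ (n - (j + 1))) /
      ((∏ i, (1 - X i)) * ∏ i, ∏ j ∈ Finset.Ioi i, ((1 - X i * X j) * (X j - X i))))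

/-- The overall factor for `m = 2 l + 1`, without its sign. -/
def oddFactor (l : ℕ) (X : Fin n → K) (w : K) : K :=
  ∏ i, X i ^ l * ((X i)⁻¹ + 1 + w + X i) * (1 + X i)

/-- The overall factor for `m = 2 l`, without its sign. -/
def evenFactor (l : ℕ) (X : Fin n → K) (w : K) : K :=
  ∏ i, X i ^ l * ((X i)⁻¹ + 1 + w + X i)

end Weights

end LittlewoodPaths

open LittlewoodPaths LittlewoodPaths.PathFamily

namespace LittlewoodPaths

/-! ### Generating functions of lattice paths -/

/-! Both sides are determinants, linked by a Newton expansion in the quantities Y_r = X_r + X_r⁻¹.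
By Leibniz, the signed sum over all families is the determinant of `pathMatrix`, whose entries are
differences of the generating functions of the paths from the two points of A_i
(`pathCount_eq_det`). Let D_d(u) be this difference for the mirror pair (-d-u, -d+u), (-d+u, -d-u),
and let T shift u to u+1. Decomposing by the first step, one passes from D_d back to D_(d-1) by
applying 1 - x_d T, where x_d is the weight on that diagonal. The weights come in pairs X_i, X_i⁻¹,
so two consecutive diagonals give 1 - Y_i T + T² (`levelGF_add_two`). At the bottom of this
recursion sits the odd function p_(e+u) - p_(e-u) of u, where p is the generating polynomial of the
upper parts. Summation against the Chebyshev values S_k(y) inverts 1 - yT + T². As 1 - Y_i T + T² =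
(1 - yT + T²) + (y - Y_i)T, summing level zero against S_k(y) produces an expansion in the Newton
products ∏_(s<i) (y - Y_s) (`sum_chebS_newton`). At y = Y_r the remainder vanishes, and the
coefficients are exactly the entries of `pathMatrix`; this is why the starting points are where they
are. The triangular factor has a Vandermonde determinant in the Y's, which accounts for ∏ (1 - X_i
X_j)(X_j - X_i). On the other side, since level zero and S are both odd, the sum collapses to Σ p_t
S_(t-e-1)(y), a row multiple of the matrix entry in `boundedRHS`. Families with a shared point
cancel by exchanging tails there (`pathCount_eq_of_imp`). This keeps the weight if the point is on
or below x+y=0, or anywhere if w=1. If w=0, the shorter paths to E'_j have the same column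
polynomial and end before weighted steps begin, so w may be reset to 1 in their weights. Finally,
planarity determines σ from the chosen starting points, which gives the explicit sign
(`perm_lt_iff`, `sign_eq`). -/

/-- The possible next points of a path. -/
noncomputable def successors (c : Bool) (s : ℤ × ℤ) : Finset (ℤ × ℤ) := by
  classical
  exact ({s + (1, 1), s + (if c then (-1, 1) else (1, -1)), s + (1, 0), s + (0, 1)} :
    Finset (ℤ × ℤ)).filter (IsStep c s)

theorem mem_successors {c : Bool} {s b : ℤ × ℤ} : b ∈ successors c s ↔ IsStep c s b := by
  classical
  refine ⟨fun h => (Finset.mem_filter.1 h).2, fun h => Finset.mem_filter.2 ⟨?_, h⟩⟩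
  rcases h with ⟨-, -, h | h⟩ | ⟨-, h | h⟩ <;> simp [h]

theorem successors_above (c : Bool) {s : ℤ × ℤ} (hs : 0 < s.1 + s.2) :
    successors c s = {s + (1, 0), s + (0, 1)} := by
  ext b
  rw [mem_successors]
  simp only [IsStep, Finset.mem_insert, Finset.mem_singleton]
  have h1 : ¬ s.1 + s.2 ≤ 0 := by omega
  simp [h1, hs.le]

theorem successors_below (c : Bool) {s : ℤ × ℤ} (hs : s.1 + s.2 ≤ -2) :
    successors c s = {s + (1, 1), s + if c then (-1, 1) else (1, -1)} := by
  ext b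
  rw [mem_successors]
  simp only [IsStep, Finset.mem_insert, Finset.mem_singleton]
  have h1 : ¬ 0 ≤ s.1 + s.2 := by omega
  have h2 : s.1 + s.2 ≤ 0 := by omega
  simp only [h1, h2, false_and, true_and, or_false]
  refine ⟨fun h => h.2, fun h => ⟨?_, h⟩⟩
  cases c <;> rcases h with h | h <;> subst h <;> simp <;> omega

/-- On the line itself (1, 1) is lost, as its end lies above, but a path may still move along the
line. -/
theorem successors_zero (c : Bool) {s : ℤ × ℤ} (hs : s.1 + s.2 = 0) :
    successors c s = {s + if c then (-1, 1) else (1, -1), s + (1, 0), s + (0, 1)} := by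
  ext b
  rw [mem_successors]
  simp only [IsStep, Finset.mem_insert, Finset.mem_singleton]
  simp only [hs, le_refl, true_and]
  constructor
  · rintro (⟨h, h' | h'⟩ | h)
    · subst h'; simp at h; omega
    · exact Or.inl h'
    · exact Or.inr h
  · rintro (h | h)
    · left
      refine ⟨?_, Or.inr h⟩
      cases c <;> subst h <;> simp <;> omega
    · exact Or.inr h

/-- Along a step the sum of the coordinates does not decrease. -/
theorem IsStep.sum_le {c : Bool} {P Q : ℤ × ℤ} (h : IsStep c P Q) : P.1 + P.2 ≤ Q.1 + Q.2 := by
  obtain ⟨a, b⟩ := P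
  cases c <;> rcases h with ⟨-, -, h | h⟩ | ⟨-, h | h⟩ <;> subst h <;> simp <;> omega

theorem isLatticePath_iff_cons {c : Bool} {s e b : ℤ × ℤ} {t : List (ℤ × ℤ)}
    (hb : t.head? = some b) :
    IsLatticePath c s e (s :: t) ↔ IsStep c s b ∧ IsLatticePath c b e t := by
  match t, hb with
  | a :: t, hb =>
    simp only [List.head?_cons, Option.some.injEq] at hb
    subst hb
    simp [IsLatticePath, List.isChain_cons_cons]
    tauto

theorem IsLatticePath.sum_le {c : Bool} {e : ℤ × ℤ} :
    ∀ {p : List (ℤ × ℤ)} {s : ℤ × ℤ}, IsLatticePath c s e p → s.1 + s.2 ≤ e.1 + e.2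
  | [], _, h => by simp [IsLatticePath] at h
  | [a], s, h => by
    have h1 : a = s := by simpa using h.1
    have h2 : a = e := by simpa using h.2.1
    rw [← h1, h2]
  | a :: b :: t, s, h => by
    obtain ⟨-, h2, h3⟩ := h.cons_cons
    exact h2.sum_le.trans h3.sum_le

section

variable {K : Type*} [Field K] {n : ℕ}

/-- The generating function of the paths from `s` to `e`. -/
noncomputable def pathGF (X : Fin n → K) (w : K) (j : ℕ) (c : Bool) (s e : ℤ × ℤ) : K :=
  ∑ p ∈ (finite_setOf_isLatticePath c s e).toFinset, pathWeight X w j p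

theorem pathGF_eq_zero_of_forall {X : Fin n → K} {w : K} {j : ℕ} {c : Bool} {s e : ℤ × ℤ}
    (h : ∀ p, ¬ IsLatticePath c s e p) : pathGF X w j c s e = 0 := by
  refine Finset.sum_eq_zero fun p hp => ?_
  exact absurd (by simpa using hp) (h p)

theorem pathGF_eq_zero_of_potential {X : Fin n → K} {w : K} {j : ℕ} {c : Bool} {s e : ℤ × ℤ}
    (h : potential c e < potential c s) : pathGF X w j c s e = 0 :=
  pathGF_eq_zero_of_forall fun _ hp => absurd hp.potential_le (not_le.2 h)

theorem pathGF_eq_zero_of_sum {X : Fin n → K} {w : K} {j : ℕ} {c : Bool} {s e : ℤ × ℤ}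
    (h : e.1 + e.2 < s.1 + s.2) : pathGF X w j c s e = 0 :=
  pathGF_eq_zero_of_forall fun _ hp => absurd hp.sum_le (not_le.2 h)

theorem pathWeight_cons (X : Fin n → K) (w : K) (j : ℕ) (s : ℤ × ℤ) {b : ℤ × ℤ}
    {t : List (ℤ × ℤ)} (hb : t.head? = some b) :
    pathWeight X w j (s :: t) = stepWeight X w j s b * pathWeight X w j t := by
  match t, hb with
  | a :: t, hb =>
    simp only [List.head?_cons, Option.some.injEq] at hb
    subst hb
    simp [pathWeight]

/-- Decomposition according to the first step. -/
theorem pathGF_eq (X : Fin n → K) (w : K) (j : ℕ) (c : Bool) (s e : ℤ × ℤ) :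
    pathGF X w j c s e = (if s = e then 1 else 0) +
      ∑ b ∈ successors c s, stepWeight X w j s b * pathGF X w j c b e := by
  classical
  have hU : (finite_setOf_isLatticePath c s e).toFinset =
      (if s = e then {[s]} else ∅) ∪ (successors c s).biUnion fun b =>
        ((finite_setOf_isLatticePath c b e).toFinset).image (List.cons s) := by
    ext p
    simp only [Set.Finite.mem_toFinset, Set.mem_ofPred_eq, Finset.mem_union, Finset.mem_biUnion,
      Finset.mem_image, mem_successors]
    constructor
    · intro h
      match p, h with
      | [], h => simp [IsLatticePath] at h
      | [a], h =>
        have h1 : a = s := by simpa using h.1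
        have h2 : a = e := by simpa using h.2.1
        left; simp [h1, ← h2]
      | a :: b :: t, h =>
        right
        obtain ⟨rfl, h2, h3⟩ := h.cons_cons
        exact ⟨b, h2, b :: t, h3, rfl⟩
    · rintro (h | ⟨b, hb, t, ht, rfl⟩)
      · split_ifs at h with hse
        · simp only [Finset.mem_singleton] at h
          subst h hse
          simp [IsLatticePath]
        · simp at h
      · exact (isLatticePath_iff_cons ht.1).2 ⟨hb, ht⟩
  rw [pathGF, hU, Finset.sum_union, Finset.sum_biUnion]
  · congr 1
    · split_ifs <;> simp [pathWeight]
    · refine Finset.sum_congr rfl fun b _ => ?_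
      rw [Finset.sum_image fun x _ y _ h => List.cons_injective h, pathGF, Finset.mul_sum]
      refine Finset.sum_congr rfl fun t ht => pathWeight_cons X w j s ?_
      exact (show IsLatticePath c b e t by simpa using ht).1
  · intro b _ b' _ hbb'
    refine Finset.disjoint_left.2 fun p hp hp' => hbb' ?_
    simp only [Finset.mem_image, Set.Finite.mem_toFinset, Set.mem_ofPred_eq] at hp hp'
    obtain ⟨t, ht, rfl⟩ := hp
    obtain ⟨t', ht', h⟩ := hp'
    obtain rfl : t' = t := List.cons_injective h
    exact Option.some_injective _ (ht.1.symm.trans ht'.1)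
  · refine Finset.disjoint_left.2 fun p hp hp' => ?_
    simp only [Finset.mem_biUnion, Finset.mem_image, Set.Finite.mem_toFinset,
      Set.mem_ofPred_eq] at hp'
    obtain ⟨b, -, t, ht, rfl⟩ := hp'
    split_ifs at hp with hse
    · simp only [Finset.mem_singleton, List.cons.injEq, true_and] at hp
      subst hp
      simp [IsLatticePath] at ht
    · simp at hp

/-! ### The part above the line `x + y = 0` -/

/-- The weight of a horizontal step starting on `x + y = r`. -/
def horizontalWeight (w : K) (j r : ℕ) : K := if j ≤ r + 1 then w else 1

/-- The generating polynomial of the paths from the line `x + y = t` to the line `x + y = L`, with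
respect to the number of horizontal steps. -/
noncomputable def abovePoly (w : K) (j t L : ℕ) : Polynomial K :=
  ∏ r ∈ Finset.Ico t L, (1 + Polynomial.C (horizontalWeight w j r) * Polynomial.X)

/-- The coefficient of a polynomial at an integer. -/
noncomputable def intCoeff (p : Polynomial K) (k : ℤ) : K := if 0 ≤ k then p.coeff k.toNat else 0

theorem intCoeff_one (k : ℤ) : intCoeff (1 : Polynomial K) k = if k = 0 then 1 else 0 := by
  rw [intCoeff, Polynomial.coeff_one]
  split_ifs <;> first | rfl | omega

theorem intCoeff_mul (a : K) (p : Polynomial K) (k : ℤ) :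
    intCoeff ((1 + Polynomial.C a * Polynomial.X) * p) k =
      a * intCoeff p (k - 1) + intCoeff p k := by
  have h : (1 + Polynomial.C a * Polynomial.X) * p
      = p + Polynomial.C a * (Polynomial.X * p) := by ring
  rw [h]
  unfold intCoeff
  rcases lt_trichotomy k 0 with hk | hk | hk
  · simp [show ¬ 0 ≤ k by omega, show ¬ 1 ≤ k by omega]
  · subst hk; simp
  · obtain ⟨m, rfl⟩ : ∃ m : ℕ, k = m + 1 := ⟨(k - 1).toNat, by omega⟩
    have h1 : ((m : ℤ) + 1).toNat = m + 1 := by omega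
    simp [h1, show (0 : ℤ) ≤ m + 1 by omega, add_comm]

theorem stepWeight_right (X : Fin n → K) (w : K) {j t : ℕ} {s : ℤ × ℤ}
    (hs : s.1 + s.2 = t) :
    stepWeight X w j s (s + (1, 0)) = horizontalWeight w j t := by
  have h1 : ¬ ((s + (1, 0)).1 + (s + (1, 0)).2 = s.1 + s.2) := by simp
  rw [stepWeight, if_neg h1, horizontalWeight]
  have h2 : (j : ℤ) - 1 ≤ s.1 + s.2 ↔ j ≤ t + 1 := by omega
  simp only [true_and, h2]

theorem stepWeight_up (X : Fin n → K) (w : K) (j : ℕ) (s : ℤ × ℤ) :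
    stepWeight X w j s (s + (0, 1)) = 1 := by
  have h1 : ¬ ((s + (0, 1)).1 + (s + (0, 1)).2 = s.1 + s.2) := by simp
  rw [stepWeight, if_neg h1, if_neg]
  simp

theorem stepWeight_up_right (X : Fin n → K) (w : K) (j : ℕ) (s : ℤ × ℤ) :
    stepWeight X w j s (s + (1, 1)) = 1 := by
  have h1 : ¬ ((s + (1, 1)).1 + (s + (1, 1)).2 = s.1 + s.2) := by simp; omega
  rw [stepWeight, if_neg h1, if_neg]
  simp

theorem stepWeight_diagonal (X : Fin n → K) (w : K) (j : ℕ) (c : Bool) (s : ℤ × ℤ) :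
    stepWeight X w j s (s + if c then (-1, 1) else (1, -1)) =
      diagonalWeight X (-(s.1 + s.2) / 2).toNat := by
  rw [stepWeight, if_pos]
  cases c <;> simp <;> omega

/-- The contribution of the steps `(1, 0)` and `(0, 1)` in a point `s` with `x + y = t`. -/
theorem above_recurrence (X : Fin n → K) (w : K) (j : ℕ) (c : Bool) {e : ℤ × ℤ} {L : ℕ}
    (he : e.1 + e.2 = L) {t : ℕ} {s : ℤ × ℤ} (hs : s.1 + s.2 = t) (htL : t ≤ L)
    (ih : t < L → ∀ b : ℤ × ℤ, b.1 + b.2 = (t + 1 : ℕ) →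
      pathGF X w j c b e = intCoeff (abovePoly w j (t + 1) L) (e.1 - b.1)) :
    (if s = e then 1 else 0) +
      (stepWeight X w j s (s + (1, 0)) * pathGF X w j c (s + (1, 0)) e +
        stepWeight X w j s (s + (0, 1)) * pathGF X w j c (s + (0, 1)) e) =
      intCoeff (abovePoly w j t L) (e.1 - s.1) := by
  rcases htL.lt_or_eq with h | h
  · have hse : s ≠ e := by rintro rfl; omega
    rw [if_neg hse, stepWeight_right X w hs, stepWeight_up, ih h, ih h, abovePoly,
      abovePoly, Finset.prod_eq_prod_Ico_succ_bot h, intCoeff_mul, zero_add,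
      one_mul]
    · congr 2
      · simp; congr 1; ring
      · simp
    · simp; omega
    · simp; omega
  -- On the line of the endpoint every further step overshoots, so only the trivial path remains.
  · subst h
    rw [pathGF_eq_zero_of_sum, pathGF_eq_zero_of_sum]
    · have : s = e ↔ e.1 - s.1 = 0 := by rw [Prod.ext_iff]; omega
      simp [abovePoly, intCoeff_one, this]
    · simp; omega
    · simp; omega

theorem pathGF_above (X : Fin n → K) (w : K) (j : ℕ) (c : Bool) {e : ℤ × ℤ} {L : ℕ}
    (he : e.1 + e.2 = L) (k : ℕ) : ∀ {t : ℕ} {s : ℤ × ℤ}, t + k = L → 0 < t →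
      s.1 + s.2 = t → pathGF X w j c s e = intCoeff (abovePoly w j t L) (e.1 - s.1) := by
  induction k with
  | zero =>
    intro t s htk ht hs
    rw [pathGF_eq, successors_above c (by omega), Finset.sum_pair (by simp)]
    exact above_recurrence X w j c he hs (by omega) (by omega)
  | succ k ih =>
    intro t s htk ht hs
    rw [pathGF_eq, successors_above c (by omega), Finset.sum_pair (by simp)]
    exact above_recurrence X w j c he hs (by omega) fun _ b hb => ih (by omega) (by omega) hb

/-! ### The part below the line `x + y = 0` -/

/-- The difference of the generating functions of the paths that start in the two points on the
line `x + y = -2 d` at distance `u` from the origin, in suitable units. -/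
noncomputable def diffGF (X : Fin n → K) (w : K) (j : ℕ) (e : ℤ × ℤ) (d : ℕ) (u : ℤ) : K :=
  pathGF X w j true (-d - u, -d + u) e - pathGF X w j false (-d + u, -d - u) e

theorem pathGF_succ (X : Fin n → K) (w : K) (j : ℕ) (c : Bool) {e : ℤ × ℤ} (he : 0 ≤ e.1 + e.2)
    (d : ℕ) {s : ℤ × ℤ} (hs : s.1 + s.2 = -2 * (d + 1 : ℕ)) :
    pathGF X w j c s e = diagonalWeight X (d + 1) *
        pathGF X w j c (s + if c then (-1, 1) else (1, -1)) e + pathGF X w j c (s + (1, 1)) e := by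
  have hse : s ≠ e := by rintro rfl; omega
  rw [pathGF_eq, if_neg hse, successors_below c (by omega), Finset.sum_pair,
    stepWeight_up_right, stepWeight_diagonal]
  · have : (-(s.1 + s.2) / 2).toNat = d + 1 := by omega
    rw [this]; ring
  · cases c <;> simp

theorem pathGF_zero (X : Fin n → K) (w : K) (j : ℕ) (c : Bool) {e : ℤ × ℤ} {L : ℕ}
    (he : e.1 + e.2 = L) {s : ℤ × ℤ} (hs : s.1 + s.2 = 0) :
    pathGF X w j c s e = diagonalWeight X 0 *
        pathGF X w j c (s + if c then (-1, 1) else (1, -1)) e +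
      intCoeff (abovePoly w j 0 L) (e.1 - s.1) := by
  rw [pathGF_eq, successors_zero c hs, Finset.sum_insert, Finset.sum_pair (by simp),
    stepWeight_diagonal, ← above_recurrence X w j c he (t := 0) (by simpa using hs) (by omega)]
  · have : (-(s.1 + s.2) / 2).toNat = 0 := by omega
    rw [this]; ring
  · intro h b hb
    exact pathGF_above X w j c he (L - 1) (by omega) (by omega) hb
  · cases c <;> simp

/-- The two step sets are mirror images: the diagonal step raises `u` by one, the step (1, 1) keeps
`u` and lowers the distance. Both sides carry the same weights, so the difference inherits the
recursion. -/
theorem diffGF_succ (X : Fin n → K) (w : K) (j : ℕ) {e : ℤ × ℤ} (he : 0 ≤ e.1 + e.2)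
    (d : ℕ) (u : ℤ) :
    diffGF X w j e (d + 1) u =
      diagonalWeight X (d + 1) * diffGF X w j e (d + 1) (u + 1) + diffGF X w j e d u := by
  simp only [diffGF]
  rw [pathGF_succ X w j true he d (by push_cast; ring),
    pathGF_succ X w j false he d (by push_cast; ring)]
  simp only [if_true, Bool.false_eq_true, if_false, Prod.mk_add_mk]
  push_cast
  ring_nf

/-- The inhomogeneous term, coming from paths that leave the line at (-u, u) or (u, -u), is odd in
`u`; this is what later matches the oddness of `chebS`. -/
theorem diffGF_zero (X : Fin n → K) (w : K) (j : ℕ) {e : ℤ × ℤ} {L : ℕ}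
    (he : e.1 + e.2 = L) (u : ℤ) :
    diffGF X w j e 0 u = diagonalWeight X 0 * diffGF X w j e 0 (u + 1) +
      (intCoeff (abovePoly w j 0 L) (e.1 + u) - intCoeff (abovePoly w j 0 L) (e.1 - u)) := by
  simp only [diffGF]
  rw [pathGF_zero X w j true he (by push_cast; ring),
    pathGF_zero X w j false he (by push_cast; ring)]
  simp only [if_true, Bool.false_eq_true, if_false, Prod.mk_add_mk]
  push_cast
  ring_nf

/-- Both starting points have potential 2u - 4d, which exceeds that of `e` for large `u`. Hence all
sums over `u` are effectively finite. -/
theorem diffGF_eq_zero (X : Fin n → K) (w : K) (j : ℕ) (e : ℤ × ℤ) (d : ℕ) (u : ℤ)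
    (hu : max (potential true e) (potential false e) + 4 * d < 2 * u) :
    diffGF X w j e d u = 0 := by
  have h1 := le_max_left (potential true e) (potential false e)
  have h2 := le_max_right (potential true e) (potential false e)
  rw [diffGF, pathGF_eq_zero_of_potential, pathGF_eq_zero_of_potential, sub_zero]
  · simp only [potential, Bool.false_eq_true, if_false] at *; omega
  · simp only [potential, if_true] at *; omega

end

/-! ### Rescaled Chebyshev polynomials -/

section

variable {K : Type*} [Field K] {n : ℕ}

open Polynomial.Chebyshev in
/-- The value at `y` of the rescaled Chebyshev polynomial of the second kind. -/
noncomputable def chebS (y : K) (a : ℤ) : K := (S K a).eval y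

theorem chebS_add_one (y : K) (a : ℤ) : chebS y (a + 1) = y * chebS y a - chebS y (a - 1) := by
  simp [chebS, Polynomial.Chebyshev.S_add_one K a]

theorem chebS_neg_one (y : K) : chebS y (-1) = 0 := by simp [chebS]

theorem chebS_zero (y : K) : chebS y 0 = 1 := by simp [chebS]

theorem chebS_neg_sub_one (y : K) (a : ℤ) : chebS y (-a - 1) = -chebS y (a - 1) := by
  simp [chebS, Polynomial.Chebyshev.S_neg_sub_one]

theorem eq_of_recurrence {y : K} {f g : ℤ → K} (hf : ∀ a, f (a + 1) = y * f a - f (a - 1))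
    (hg : ∀ a, g (a + 1) = y * g a - g (a - 1)) (h0 : f 0 = g 0) (h1 : f 1 = g 1) (a : ℤ) :
    f a = g a := by
  have key : ∀ k : ℕ, (f k = g k ∧ f (k + 1) = g (k + 1)) ∧
      (f (-k) = g (-k) ∧ f (-k + 1) = g (-k + 1)) := by
    intro k
    induction k with
    | zero => simpa using ⟨h0, h1⟩
    | succ k ih =>
      obtain ⟨⟨i1, i2⟩, i3, i4⟩ := ih
      push_cast
      refine ⟨⟨i2, ?_⟩, ?_, ?_⟩
      · rw [hf, hg, i2]; simp [i1]
      · have e1 := hf (-k)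
        have e2 := hg (-k)
        rw [show -((k : ℤ) + 1) = -k - 1 by ring]
        linear_combination y * i3 - i4 + e1 - e2
      · rw [show -((k : ℤ) + 1) + 1 = -k by ring, i3]
  rcases Int.eq_nat_or_neg a with ⟨k, rfl | rfl⟩
  · exact (key k).1.1
  · exact (key k).2.1

/-- Both sides satisfy the same three-term recurrence and agree at 0 and 1. No division by x - x⁻¹
is needed, which matters because x = -1 is allowed. -/
theorem zpow_sub_zpow_neg {x : K} (hx : x ≠ 0) (a : ℤ) :
    x ^ a - x ^ (-a) = (x - x⁻¹) * chebS (x + x⁻¹) (a - 1) := by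
  refine eq_of_recurrence (y := x + x⁻¹) (f := fun a => x ^ a - x ^ (-a))
    (g := fun a => (x - x⁻¹) * chebS (x + x⁻¹) (a - 1)) (fun a => ?_) (fun a => ?_) ?_ ?_ a
  · simp only [neg_add, sub_eq_add_neg, neg_neg, zpow_add₀ hx, zpow_neg, zpow_one]
    field_simp
    ring
  · have := chebS_add_one (x + x⁻¹) (a - 1)
    simp only [sub_add_cancel] at this
    simp only [add_sub_cancel_right]
    rw [this]; ring
  · simp [chebS_neg_one]
  · simp [chebS_zero]

theorem zpow_sub_zpow_one_sub {x : K} (hx : x ≠ 0) (a : ℤ) :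
    x ^ a - x ^ (1 - a) =
      (x - 1) * (chebS (x + x⁻¹) (a - 1) + chebS (x + x⁻¹) (a - 2)) := by
  refine eq_of_recurrence (y := x + x⁻¹) (f := fun a => x ^ a - x ^ (1 - a))
    (g := fun a => (x - 1) * (chebS (x + x⁻¹) (a - 1) + chebS (x + x⁻¹) (a - 2)))
    (fun a => ?_) (fun a => ?_) ?_ ?_ a
  · simp only [neg_add, sub_eq_add_neg, neg_neg, zpow_add₀ hx, zpow_neg, zpow_one]
    field_simp
    ring
  · have h1 := chebS_add_one (x + x⁻¹) (a - 1)
    have h2 := chebS_add_one (x + x⁻¹) (a - 2)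
    simp only [sub_add_cancel] at h1
    rw [show a - 2 + 1 = a - 1 by ring] at h2
    have h3 : a + 1 - 2 = a - 1 := by ring
    have h4 : a - 1 - 2 = a - 2 - 1 := by ring
    simp only [add_sub_cancel_right, h3, h4]
    rw [h1, h2]; ring
  · have := chebS_neg_sub_one (x + x⁻¹) 1
    norm_num [chebS_zero] at this
    simp [chebS_neg_one, this]
  · simp [chebS_zero, chebS_neg_one]

/-! ### Newton interpolation -/

/-- Summation against `chebS y` inverts 1 - yT + T², T being the shift, up to boundary terms at `N`.
-/
theorem sum_chebS_mul (y : K) (a : ℕ → K) (N : ℕ) :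
    ∑ k ∈ Finset.range N, chebS y k * (a k - y * a (k + 1) + a (k + 2)) =
      a 0 + chebS y (N - 1) * a (N + 1) - chebS y N * a N := by
  induction N with
  | zero => simp [chebS_neg_one, chebS_zero]
  | succ N ih =>
    rw [Finset.sum_range_succ, ih]
    have := chebS_add_one y N
    push_cast
    rw [this]
    simp only [add_sub_cancel_right]
    ring_nf

/-- Write 1 - cT + T² = (1 - yT + T²) + (y - c)T and invert the first summand by `sum_chebS_mul`;
the boundary terms vanish by `h0`. -/
theorem sum_chebS_step (y c : K) {G G' : ℤ → K} (N : ℕ) (i : ℕ)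
    (h : ∀ u, G u = G' u - c * G' (u + 1) + G' (u + 2)) (h0 : ∀ u, (N : ℤ) ≤ u → G' u = 0) :
    ∑ k ∈ Finset.range N, chebS y k * G (i + 1 + k) =
      G' (i + 1) + (y - c) * ∑ k ∈ Finset.range N, chebS y k * G' ((i + 1 : ℕ) + 1 + k) := by
  have h1 := sum_chebS_mul y (fun k => G' (i + 1 + k)) N
  rw [h0 (i + 1 + N) (by omega), h0 (i + 1 + (N + 1 : ℕ)) (by omega)] at h1
  simp only [Nat.cast_zero, add_zero, mul_zero, sub_zero] at h1
  rw [← h1, Finset.mul_sum, ← Finset.sum_add_distrib]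
  refine Finset.sum_congr rfl fun k _ => ?_
  rw [h]
  push_cast
  rw [show (i : ℤ) + 1 + k + 1 = i + 1 + 1 + k by ring,
    show (i : ℤ) + 1 + (k + 1) = i + 1 + 1 + k by ring,
    show (i : ℤ) + 1 + (k + 2) = i + 1 + k + 2 by ring]
  ring

theorem sum_chebS_newton (y : K) (Y : ℕ → K) (F : ℕ → ℤ → K) (N m : ℕ)
    (h : ∀ i < m, ∀ u, F i u = F (i + 1) u - Y i * F (i + 1) (u + 1) + F (i + 1) (u + 2))
    (h0 : ∀ i < m, ∀ u, (N : ℤ) ≤ u → F (i + 1) u = 0) :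
    ∑ k ∈ Finset.range N, chebS y k * F 0 (1 + k) =
      ∑ i ∈ Finset.range m, (∏ s ∈ Finset.range i, (y - Y s)) * F (i + 1) (i + 1) +
        (∏ s ∈ Finset.range m, (y - Y s)) *
          ∑ k ∈ Finset.range N, chebS y k * F m (m + 1 + k) := by
  induction m with
  | zero => simp
  | succ m ih =>
    rw [ih (fun i hi => h i (by omega)) (fun i hi => h0 i (by omega)),
      sum_chebS_step y (Y m) N m (h m (by omega)) (h0 m (by omega)),
      Finset.sum_range_succ, Finset.prod_range_succ]
    push_cast
    ring

/-- The bilinear expansion behind the determinant evaluation. -/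
theorem sum_chebS_eq_sum_fin (Y : ℕ → K) (F : ℕ → ℤ → K) (N : ℕ)
    (h : ∀ i < n, ∀ u, F i u = F (i + 1) u - Y i * F (i + 1) (u + 1) + F (i + 1) (u + 2))
    (h0 : ∀ i < n, ∀ u, (N : ℤ) ≤ u → F (i + 1) u = 0) (r : Fin n) :
    ∑ k ∈ Finset.range N, chebS (Y r) k * F 0 (1 + k) =
      ∑ i : Fin n, (∏ s ∈ Finset.range i, (Y r - Y s)) * F (i + 1) (i + 1) := by
  -- The remainder carries the full product over s < n, whose factor s = r is zero.
  rw [sum_chebS_newton (Y r) Y F N n h h0, Fin.sum_univ_eq_sum_range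
    (fun i => (∏ s ∈ Finset.range i, (Y r - Y s)) * F (i + 1) (i + 1)),
    Finset.prod_eq_zero (i := (r : ℕ)) (by simp) (by simp)]
  simp

/-- The factor s = r vanishes for r < i, so the Newton matrix is triangular, and its diagonal
entries multiply to the Vandermonde product. -/
theorem det_newton (Y : ℕ → K) :
    Matrix.det (Matrix.of fun r i : Fin n => ∏ s ∈ Finset.range i, (Y r - Y s)) =
      ∏ i : Fin n, ∏ j ∈ Finset.Ioi i, (Y j - Y i) := by
  rw [Matrix.det_of_isLowerTriangular]
  · simp only [Matrix.of_apply]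
    rw [Finset.prod_comm' (t' := Finset.univ) (s' := fun j => Finset.Iio j) (by simp)]
    refine Finset.prod_congr rfl fun j _ => ?_
    refine (Finset.prod_nbij (fun i : Fin n => (i : ℕ)) ?_ ?_ ?_ ?_).symm
    · simp
    · exact Fin.val_injective.injOn
    · intro s hs
      have hs : s < j := by simpa using hs
      exact ⟨⟨s, hs.trans j.2⟩, by simpa [Fin.lt_def] using hs, rfl⟩
    · simp
  · intro r i hri
    have hri : (r : ℕ) < i := hri
    exact Finset.prod_eq_zero (Finset.mem_range.2 hri) (sub_self _)

/-! ### Evaluation of the sums -/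

/-- The symmetry S_(-a-1) = -S_(a-1) folds negative `z` onto positive ones, and S_(-1) = 0 covers z
= 0. -/
theorem sum_chebS_indicator (y : K) {N : ℕ} {z : ℤ} (h1 : z ≤ N) (h2 : -z ≤ N) :
    ∑ k ∈ Finset.range N, chebS y k *
      ((if (1 + k : ℤ) = z then 1 else 0) - if -(1 + k : ℤ) = z then 1 else 0) =
      chebS y (z - 1) := by
  simp only [mul_sub, mul_ite, mul_one, mul_zero, Finset.sum_sub_distrib]
  rcases lt_trichotomy z 0 with hz | hz | hz
  · obtain ⟨m, rfl⟩ : ∃ m : ℕ, z = -(m + 1) := ⟨(-z - 1).toNat, by omega⟩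
    rw [Finset.sum_eq_zero, Finset.sum_eq_single m]
    · have := chebS_neg_sub_one y (m + 1)
      rw [if_pos (by ring), this]; simp
    · intro k _ hk
      rw [if_neg]; omega
    · intro hm
      simp at hm; omega
    · intro k _
      rw [if_neg]; omega
  · subst hz
    rw [Finset.sum_eq_zero, Finset.sum_eq_zero]
    · simp [chebS_neg_one]
    · intro k _
      rw [if_neg]; omega
    · intro k _
      rw [if_neg]; omega
  · obtain ⟨m, rfl⟩ : ∃ m : ℕ, z = m + 1 := ⟨(z - 1).toNat, by omega⟩
    rw [Finset.sum_eq_single m, Finset.sum_eq_zero]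
    · rw [if_pos (by ring)]; simp
    · intro k _
      rw [if_neg]; omega
    · intro k _ hk
      rw [if_neg]; omega
    · intro hm
      simp at hm; omega

theorem intCoeff_eq_sum {p : Polynomial K} (hp : p.natDegree < n) (k : ℤ) :
    intCoeff p k = ∑ t ∈ Finset.range n, p.coeff t * if k = t then 1 else 0 := by
  simp only [mul_ite, mul_one, mul_zero, intCoeff]
  split_ifs with hk
  · obtain ⟨m, rfl⟩ := Int.eq_ofNat_of_zero_le hk
    simp only [Int.toNat_natCast, Nat.cast_inj, Finset.sum_ite_eq, Finset.mem_range]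
    split_ifs with hm
    · rfl
    · exact Polynomial.coeff_eq_zero_of_natDegree_lt (by omega)
  · refine (Finset.sum_eq_zero fun t _ => ?_).symm
    rw [if_neg]; omega

theorem sum_chebS_mul_intCoeff (y : K) {p : Polynomial K} (hp : p.natDegree < n) (e : ℤ) {N : ℕ}
    (h1 : n - e ≤ N) (h2 : e ≤ N) :
    ∑ k ∈ Finset.range N, chebS y k *
      (intCoeff p (e + (1 + k : ℤ)) - intCoeff p (e - (1 + k : ℤ))) =
      ∑ t ∈ Finset.range n, p.coeff t * chebS y (t - e - 1) := by
  simp only [intCoeff_eq_sum hp, ← Finset.sum_sub_distrib, ← mul_sub, Finset.mul_sum]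
  rw [Finset.sum_comm]
  refine Finset.sum_congr rfl fun t ht => ?_
  have ht := Finset.mem_range.1 ht
  rw [← sum_chebS_indicator y (z := t - e) (N := N) (by omega) (by omega), Finset.mul_sum]
  refine Finset.sum_congr rfl fun k _ => ?_
  have e1 : (e + (1 + k) = t) ↔ (1 + k : ℤ) = t - e := by omega
  have e2 : (e - (1 + k) = t) ↔ -(1 + k : ℤ) = t - e := by omega
  simp only [e1, e2]
  ring

/-- The exponents belonging to the coefficient of index t are symmetric about l + n. Extracting
x^(l+n) leaves x^a - x^(-a), where a is t minus the first coordinate of the endpoint. -/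
theorem eval_sub_eval_inv_odd {x : K} (hx : x ≠ 0) {p : Polynomial K} {l j : ℕ}
    (hp : p.natDegree < n) (hj : j < n) :
    x ^ j * p.eval x - x ^ (2 * l + 1 + 2 * n - (j + 1)) * p.eval x⁻¹ =
      x ^ (l + n) * (x - x⁻¹) * ∑ t ∈ Finset.range n, p.coeff t *
        chebS (x + x⁻¹) (t - (n - (j + 1 : ℕ) + l + 1) - 1) := by
  rw [Polynomial.eval_eq_sum_range' hp, Polynomial.eval_eq_sum_range' hp, Finset.mul_sum,
    Finset.mul_sum, ← Finset.sum_sub_distrib, Finset.mul_sum]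
  refine Finset.sum_congr rfl fun t ht => ?_
  have ht := Finset.mem_range.1 ht
  have key := zpow_sub_zpow_neg hx (t - (n - (j + 1 : ℕ) + l + 1))
  have h1 : x ^ j * x ^ t = x ^ (l + n) * x ^ ((t : ℤ) - (n - (j + 1 : ℕ) + l + 1)) := by
    rw [← zpow_natCast, ← zpow_natCast, ← zpow_natCast, ← zpow_add₀ hx, ← zpow_add₀ hx]
    congr 1; push_cast; ring
  have h2 : x ^ (2 * l + 1 + 2 * n - (j + 1)) * x⁻¹ ^ t =
      x ^ (l + n) * x ^ (-((t : ℤ) - (n - (j + 1 : ℕ) + l + 1))) := by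
    rw [inv_pow, ← zpow_natCast, ← zpow_natCast, ← zpow_natCast, ← zpow_neg, ← zpow_add₀ hx,
      ← zpow_add₀ hx]
    congr 1; push_cast; omega
  linear_combination p.coeff t * h1 - p.coeff t * h2 + x ^ (l + n) * p.coeff t * key

/-- The centre of symmetry is now half-integral, so x^a - x^(1-a) appears; its two Chebyshev terms
correspond to the two points of E_j. -/
theorem eval_sub_eval_inv_even {x : K} (hx : x ≠ 0) {p : Polynomial K} {l j : ℕ}
    (hp : p.natDegree < n) (hj : j < n) :
    x ^ j * p.eval x - x ^ (2 * l + 2 * n - (j + 1)) * p.eval x⁻¹ =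
      x ^ (l + n - 1) * (x - 1) * (∑ t ∈ Finset.range n, p.coeff t *
        chebS (x + x⁻¹) (t - (n - (j + 1 : ℕ) + l + 1) - 1) +
        ∑ t ∈ Finset.range n, p.coeff t * chebS (x + x⁻¹) (t - (n - (j + 1 : ℕ) + l) - 1)) := by
  rw [Polynomial.eval_eq_sum_range' hp, Polynomial.eval_eq_sum_range' hp, Finset.mul_sum,
    Finset.mul_sum, ← Finset.sum_sub_distrib, ← Finset.sum_add_distrib, Finset.mul_sum]
  refine Finset.sum_congr rfl fun t ht => ?_
  have ht := Finset.mem_range.1 ht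
  have key := zpow_sub_zpow_one_sub hx (t - (n - (j + 1 : ℕ) + l))
  rw [show (t : ℤ) - (n - (j + 1 : ℕ) + l) - 2 = t - (n - (j + 1 : ℕ) + l + 1) - 1 by ring] at key
  have h1 : x ^ j * x ^ t = x ^ (l + n - 1) * x ^ ((t : ℤ) - (n - (j + 1 : ℕ) + l)) := by
    rw [← zpow_natCast, ← zpow_natCast, ← zpow_natCast, ← zpow_add₀ hx, ← zpow_add₀ hx]
    congr 1; push_cast; omega
  have h2 : x ^ (2 * l + 2 * n - (j + 1)) * x⁻¹ ^ t =
      x ^ (l + n - 1) * x ^ (1 - ((t : ℤ) - (n - (j + 1 : ℕ) + l))) := by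
    rw [inv_pow, ← zpow_natCast, ← zpow_natCast, ← zpow_natCast, ← zpow_neg, ← zpow_add₀ hx,
      ← zpow_add₀ hx]
    congr 1; push_cast; omega
  linear_combination p.coeff t * h1 - p.coeff t * h2 + x ^ (l + n - 1) * p.coeff t * key

/-! ### The generating polynomials of the upper parts -/

theorem natDegree_abovePoly_le (w : K) (j L : ℕ) : (abovePoly w j 0 L).natDegree ≤ L := by
  refine (Polynomial.natDegree_prod_le _ _).trans ?_
  refine (Finset.sum_le_card_nsmul _ _ 1 fun r _ => ?_).trans (by simp)
  change (1 + Polynomial.C (horizontalWeight w j r) * Polynomial.X).natDegree ≤ 1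
  compute_degree

theorem eval_abovePoly_of_lt (w x : K) {j L : ℕ} (h : L < j) :
    (abovePoly w j 0 L).eval x = (1 + x) ^ L := by
  rw [abovePoly, Polynomial.eval_prod, Finset.prod_congr rfl (g := fun _ => 1 + x)]
  · simp
  · intro r hr
    have hr := (Finset.mem_Ico.1 hr).2
    simp [horizontalWeight, show ¬ j ≤ r + 1 by omega]

theorem eval_abovePoly (w x : K) {j L : ℕ} (h : j ≤ L) :
    (abovePoly w (j + 1) 0 L).eval x = (1 + x) ^ j * (1 + w * x) ^ (L - j) := by
  have h1 := eval_abovePoly_of_lt w x (Nat.lt_succ_self j)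
  rw [abovePoly, Polynomial.eval_prod, ← Finset.prod_Ico_consecutive _ (Nat.zero_le j) h]
  rw [abovePoly, Polynomial.eval_prod] at h1
  rw [h1, Finset.prod_congr rfl (g := fun _ => 1 + w * x)]
  · simp
  · intro r hr
    have hr := (Finset.mem_Ico.1 hr).1
    simp [horizontalWeight, hr]

end

section

variable {K : Type*} [Field K] {n : ℕ}

/-! ### The signed count of all families as a determinant -/

/-- The signed count of the paths from `A_{i+1}` to `E_j`. -/
noncomputable def pathMatrix (E : ℕ → Finset (ℤ × ℤ)) (X : Fin n → K) (w : K) :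
    Matrix (Fin n) (Fin n) K :=
  Matrix.of fun i j => ∑ e ∈ E (j + 1), diffGF X w (j + 1) e (2 * i + 1) (i + 1)

open Classical in
/-- The paths from `A_i` to `E_j`, together with the choice of a starting point. -/
noncomputable def pathFinset (E : ℕ → Finset (ℤ × ℤ)) (i j : ℕ) :
    Finset (Bool × List (ℤ × ℤ)) :=
  Finset.univ.biUnion fun c => (E j).biUnion fun e =>
    (finite_setOf_isLatticePath c (startPoint c i) e).toFinset.image (Prod.mk c)

theorem mem_pathFinset {E : ℕ → Finset (ℤ × ℤ)} {i j : ℕ} {x : Bool × List (ℤ × ℤ)} :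
    x ∈ pathFinset E i j ↔ ∃ e ∈ E j, IsLatticePath x.1 (startPoint x.1 i) e x.2 := by
  classical
  obtain ⟨c, p⟩ := x
  simp only [pathFinset, Finset.mem_biUnion, Finset.mem_univ, true_and, Finset.mem_image,
    Set.Finite.mem_toFinset, Set.mem_ofPred_eq, Prod.mk.injEq]
  constructor
  · rintro ⟨c', e, he, q, hq, rfl, rfl⟩
    exact ⟨e, he, hq⟩
  · rintro ⟨e, he, hq⟩
    exact ⟨c, e, he, p, hq, rfl, rfl⟩

theorem sum_pathFinset (E : ℕ → Finset (ℤ × ℤ)) (X : Fin n → K) (w : K) (i j : ℕ) :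
    ∑ x ∈ pathFinset E (i + 1) j, (if x.1 then 1 else -1) * pathWeight X w j x.2 =
      ∑ e ∈ E j, diffGF X w j e (2 * i + 1) (i + 1) := by
  classical
  rw [pathFinset, Finset.sum_biUnion]
  · have key : ∀ c : Bool, ∑ x ∈ (E j).biUnion (fun e =>
        (finite_setOf_isLatticePath c (startPoint c (i + 1)) e).toFinset.image (Prod.mk c)),
        (if x.1 then 1 else -1) * pathWeight X w j x.2 =
        ∑ e ∈ E j, (if c then 1 else -1) * pathGF X w j c (startPoint c (i + 1)) e := by
      intro c
      rw [Finset.sum_biUnion]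
      · refine Finset.sum_congr rfl fun e _ => ?_
        rw [Finset.sum_image fun x _ y _ h => by simpa using h, pathGF, Finset.mul_sum]
      · intro e _ e' _ hee'
        refine Finset.disjoint_left.2 fun p hp hp' => hee' ?_
        simp only [Finset.mem_image, Set.Finite.mem_toFinset, Set.mem_ofPred_eq] at hp hp'
        obtain ⟨t, ht, rfl⟩ := hp
        obtain ⟨t', ht', h⟩ := hp'
        obtain rfl : t' = t := by simpa using h
        exact Option.some_injective _ (ht.2.1.symm.trans ht'.2.1)
    simp only [key, Fintype.sum_bool, ← Finset.sum_add_distrib]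
    refine Finset.sum_congr rfl fun e _ => ?_
    simp only [if_true, Bool.false_eq_true, if_false, startPoint, diffGF]
    push_cast
    ring_nf
  · intro c _ c' _ hcc'
    refine Finset.disjoint_left.2 fun p hp hp' => hcc' ?_
    simp only [Finset.mem_biUnion, Finset.mem_image] at hp hp'
    obtain ⟨_, _, _, _, rfl⟩ := hp
    obtain ⟨_, _, _, _, h⟩ := hp'
    exact (Prod.ext_iff.1 h).1.symm

/-- Pure Leibniz expansion: each entry is a signed sum over pairs (starting point, path), and a
product of such sums runs over all families with given σ. Nothing cancels here. -/
theorem pathCount_eq_det (E : ℕ → Finset (ℤ × ℤ)) (X : Fin n → K) (w : K) :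
    pathCount E X w sign (fun _ => True) = (pathMatrix E X w).det := by
  classical
  rw [← Matrix.det_transpose, Matrix.det_apply']
  simp only [pathMatrix, Matrix.transpose_apply, Matrix.of_apply, ← sum_pathFinset]
  simp only [Finset.prod_univ_sum, Finset.mul_sum]
  rw [Finset.sum_sigma', pathCount]
  refine Finset.sum_bij (fun F _ => ⟨F.perm, fun i => (F.start i, F.path i)⟩) ?_ ?_ ?_ ?_
  · intro F _
    simp only [Finset.mem_sigma, Finset.mem_univ, true_and, Fintype.mem_piFinset, mem_pathFinset]
    exact F.isPath
  · intro F _ G _ h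
    simp only [Sigma.mk.injEq, heq_eq_eq] at h
    have h2 := fun i => Prod.ext_iff.1 (congrFun h.2 i)
    exact PathFamily.ext h.1 (funext fun i => (h2 i).1) (funext fun i => (h2 i).2)
  · rintro ⟨σ, f⟩ hf
    simp only [Finset.mem_sigma, Finset.mem_univ, true_and, Fintype.mem_piFinset,
      mem_pathFinset] at hf
    exact ⟨⟨σ, fun i => (f i).1, fun i => (f i).2, hf⟩, by simp, rfl⟩
  · intro F _
    simp only [PathFamily.sign, PathFamily.weight, Finset.prod_mul_distrib]
    push_cast
    ring

/-! ### The determinant in the bounded identity -/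

/-- The generating functions on the successive diagonals, where `0` stands for the contribution
of the paths above `x + y = 0`. -/
noncomputable def levelGF (E : Finset (ℤ × ℤ)) (X : Fin n → K) (w : K) (j : ℕ) : ℕ → ℤ → K
  | 0, u => ∑ e ∈ E, (intCoeff (abovePoly w j 0 (e.1 + e.2).toNat) (e.1 + u) -
      intCoeff (abovePoly w j 0 (e.1 + e.2).toNat) (e.1 - u))
  | d + 1, u => ∑ e ∈ E, diffGF X w j e d u

theorem levelGF_succ {E : Finset (ℤ × ℤ)} (hE : ∀ e ∈ E, 0 ≤ e.1 + e.2) (X : Fin n → K) (w : K)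
    (j d : ℕ) (u : ℤ) :
    levelGF E X w j d u =
      levelGF E X w j (d + 1) u - diagonalWeight X d * levelGF E X w j (d + 1) (u + 1) := by
  cases d with
  | zero =>
    simp only [levelGF, Finset.mul_sum, ← Finset.sum_sub_distrib]
    refine Finset.sum_congr rfl fun e he => ?_
    rw [diffGF_zero X w j (Int.toNat_of_nonneg (hE e he)).symm u]
    ring
  | succ d =>
    simp only [levelGF, Finset.mul_sum, ← Finset.sum_sub_distrib]
    refine Finset.sum_congr rfl fun e he => ?_
    rw [diffGF_succ X w j (hE e he) d u]
    ring

/-- Paired weights have product 1, so (1 - xT)(1 - x⁻¹T) = 1 - (x + x⁻¹)T + T². -/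
theorem levelGF_add_two {E : Finset (ℤ × ℤ)} (hE : ∀ e ∈ E, 0 ≤ e.1 + e.2) {X : Fin n → K}
    (hX : ∀ i, X i ≠ 0) (w : K) (j : ℕ) {i : ℕ} (hi : i < n) (u : ℤ) :
    levelGF E X w j (2 * i) u = levelGF E X w j (2 * (i + 1)) u -
      (diagonalWeight X (2 * i) + diagonalWeight X (2 * i + 1)) *
        levelGF E X w j (2 * (i + 1)) (u + 1) + levelGF E X w j (2 * (i + 1)) (u + 2) := by
  have h1 : diagonalWeight X (2 * i) * diagonalWeight X (2 * i + 1) = 1 := by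
    have h2 : (2 * i + 1) / 2 = i := by omega
    have h3 : (2 * i + 1) % 2 = 1 := by omega
    simp [diagonalWeight, h2, h3, hi, hX]
  rw [levelGF_succ hE, levelGF_succ hE _ _ _ (2 * i + 1), levelGF_succ hE _ _ _ (2 * i + 1),
    show u + 1 + 1 = u + 2 by ring, show 2 * i + 1 + 1 = 2 * (i + 1) by ring]
  linear_combination levelGF E X w j (2 * (i + 1)) (u + 2) * h1

theorem diagonalWeight_add (X : Fin n → K) (r : Fin n) :
    diagonalWeight X (2 * r) + diagonalWeight X (2 * r + 1) = X r + (X r)⁻¹ := by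
  have h2 : (2 * (r : ℕ) + 1) / 2 = r := by omega
  have h3 : (2 * (r : ℕ) + 1) % 2 = 1 := by omega
  simp [diagonalWeight, h2, h3]

/-- The matrix factors as Newton matrix times `pathMatrix`: the i-th Newton coefficient is level
2i+2 at u = i+1, that is, distance 2i+1, where the points of A_(i+1) lie. -/
theorem eventually_det_eq {E : ℕ → Finset (ℤ × ℤ)}
    (hE : ∀ j : Fin n, ∀ e ∈ E (j + 1), 0 ≤ e.1 + e.2) {X : Fin n → K} (hX : ∀ i, X i ≠ 0)
    (w : K) :
    ∀ᶠ N : ℕ in Filter.atTop,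
      Matrix.det (Matrix.of fun r j : Fin n => ∑ k ∈ Finset.range N,
        chebS (X r + (X r)⁻¹) k * levelGF (E (j + 1)) X w (j + 1) 0 (1 + k)) =
      (∏ i : Fin n, ∏ j ∈ Finset.Ioi i, (X j + (X j)⁻¹ - (X i + (X i)⁻¹))) *
        (pathMatrix E X w).det := by
  have h0 : ∀ᶠ N : ℕ in Filter.atTop, ∀ j : Fin n, ∀ e ∈ E (j + 1),
      max (potential true e) (potential false e) + 8 * n < 2 * N := by
    refine Filter.eventually_all.2 fun j => (Filter.eventually_all_finset _).2 fun e _ => ?_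
    filter_upwards [Filter.eventually_gt_atTop
      (max (potential true e) (potential false e) + 8 * n).toNat] with N hN
    omega
  filter_upwards [h0] with N hN
  have key := fun (r j : Fin n) => sum_chebS_eq_sum_fin
    (Y := fun i => diagonalWeight X (2 * i) + diagonalWeight X (2 * i + 1))
    (F := fun i => levelGF (E (j + 1)) X w (j + 1) (2 * i)) N
    (fun i hi u => levelGF_add_two (hE j) hX w (j + 1) hi u) (fun i hi u hu => by
      change levelGF (E (j + 1)) X w (j + 1) (2 * i + 1 + 1) u = 0
      refine Finset.sum_eq_zero fun e he => diffGF_eq_zero _ _ _ _ _ _ ?_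
      have := hN j e he
      push_cast
      omega) r
  have hL := det_newton (n := n)
    (fun i => diagonalWeight X (2 * i) + diagonalWeight X (2 * i + 1))
  simp only [diagonalWeight_add] at key hL
  rw [← hL, ← Matrix.det_mul]
  congr 1
  ext r j
  simp only [Matrix.of_apply, Matrix.mul_apply]
  rw [key r j]
  rfl

theorem prod_Ioi_mul (X : Fin n → K) :
    ∏ i : Fin n, ∏ j ∈ Finset.Ioi i, X i * X j = ∏ i, X i ^ (n - 1) := by
  simp only [Finset.prod_mul_distrib]
  rw [Finset.prod_comm' (s := Finset.univ) (t := fun i => Finset.Ioi i) (t' := Finset.univ)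
    (s' := fun j => Finset.Iio j) (f := fun _ j => X j) (by simp), ← Finset.prod_mul_distrib]
  refine Finset.prod_congr rfl fun i _ => ?_
  rw [Finset.prod_const, Finset.prod_const, Fin.card_Ioi, Fin.card_Iio, ← pow_add]
  congr 1
  omega

theorem prod_Ioi_neg_one :
    ∏ i : Fin n, ∏ _j ∈ Finset.Ioi i, (-1 : K) = (-1) ^ n.choose 2 := by
  rw [Finset.prod_comm' (t' := Finset.univ) (s' := fun j => Finset.Iio j) (by simp)]
  simp only [Finset.prod_const, Fin.card_Iio]
  rw [Finset.prod_pow_eq_pow_sum, Fin.sum_univ_eq_sum_range (fun i => i), Finset.sum_range_id,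
    Nat.choose_two_right]

/-- Each pair contributes X_i X_j (Y_j - Y_i) = -(1 - X_i X_j)(X_j - X_i), with Y_i = X_i + X_i⁻¹.
-/
theorem prod_Ioi_sub (X : Fin n → K) (hX : ∀ i, X i ≠ 0) :
    (∏ i, X i ^ (n - 1)) *
      ∏ i : Fin n, ∏ j ∈ Finset.Ioi i, (X j + (X j)⁻¹ - (X i + (X i)⁻¹)) =
      (-1) ^ n.choose 2 * ∏ i, ∏ j ∈ Finset.Ioi i, ((1 - X i * X j) * (X j - X i)) := by
  rw [← prod_Ioi_mul, ← prod_Ioi_neg_one]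
  simp only [← Finset.prod_mul_distrib]
  refine Finset.prod_congr rfl fun i _ => Finset.prod_congr rfl fun j _ => ?_
  have := hX i
  have := hX j
  field_simp
  ring

/-- The evaluation of the right-hand side of the bounded identity, given the expansion of the
entries of its determinant. -/
theorem boundedRHS_eq_of_entries {E : ℕ → Finset (ℤ × ℤ)}
    (hE : ∀ j : Fin n, ∀ e ∈ E (j + 1), 0 ≤ e.1 + e.2) {X : Fin n → K} (hX : ∀ i, X i ≠ 0)
    (hX_one : ∀ i, X i ≠ 1) (hX_ne : ∀ i j, i < j → X i ≠ X j)
    (hX_mul : ∀ i j, i < j → X i * X j ≠ 1) (w : K) (m : ℕ) (g : Fin n → K)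
    (h : ∀ᶠ N : ℕ in Filter.atTop, ∀ r j : Fin n,
      X r ^ (j : ℕ) * (1 + X r) ^ (j : ℕ) * (1 + w * X r) ^ (n - (j + 1))
          - X r ^ (m + 2 * n - (j + 1)) * (1 + (X r)⁻¹) ^ (j : ℕ)
            * (1 + w * (X r)⁻¹) ^ (n - (j + 1)) =
        (X r ^ (n - 1) * (-1 * (1 - X r) * g r)) * ∑ k ∈ Finset.range N,
          chebS (X r + (X r)⁻¹) k * levelGF (E (j + 1)) X w (j + 1) 0 (1 + k)) :
    boundedRHS m X w = (-1) ^ (n + 1).choose 2 * (∏ i, ((X i)⁻¹ + 1 + w + X i) * g i) *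
      pathCount E X w sign (fun _ => True) := by
  obtain ⟨N, h1, h2⟩ := (h.and (eventually_det_eq hE hX w)).exists
  have hdet := Matrix.det_mul_column (fun r => X r ^ (n - 1) * (-1 * (1 - X r) * g r))
    (Matrix.of fun r j : Fin n => ∑ k ∈ Finset.range N,
        chebS (X r + (X r)⁻¹) k * levelGF (E (j + 1)) X w (j + 1) 0 (1 + k))
  rw [h2] at hdet
  have hW : ∏ i, ∏ j ∈ Finset.Ioi i, ((1 - X i * X j) * (X j - X i)) ≠ 0 := by
    refine Finset.prod_ne_zero_iff.2 fun i _ => Finset.prod_ne_zero_iff.2 fun j hj => ?_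
    have hj := Finset.mem_Ioi.1 hj
    exact mul_ne_zero (sub_ne_zero.2 (hX_mul i j hj).symm) (sub_ne_zero.2 (hX_ne i j hj).symm)
  have hP : ∏ i, (1 - X i) ≠ 0 :=
    Finset.prod_ne_zero_iff.2 fun i _ => sub_ne_zero.2 (hX_one i).symm
  rw [boundedRHS, pathCount_eq_det]
  simp only [h1]
  simp only [Matrix.of_apply] at hdet
  rw [hdet]
  simp only [Finset.prod_mul_distrib, Finset.prod_const, Finset.card_univ, Fintype.card_fin]
  have hV := prod_Ioi_sub X hX
  simp only [Finset.prod_mul_distrib] at hV hW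
  -- The sign splits as n plus `n.choose 2`: one -1 per row factor and one per pair in the
  -- Vandermonde product.
  rw [Nat.choose_succ_succ' n 1, Nat.choose_one_right, pow_add, mul_div_assoc',
    div_eq_iff (mul_ne_zero hP hW)]
  linear_combination (∏ i, ((X i)⁻¹ + 1 + w + X i)) * (-1) ^ n * (∏ i, (1 - X i)) * (∏ i, g i) *
    (pathMatrix E X w).det * hV

/-! ### The identity for all families -/

theorem boundedRHS_odd_eq {E : ℕ → Finset (ℤ × ℤ)} {l : ℕ} {w : K}
    (hE : ∀ j : Fin n, ∃ (b : ℤ) (L : ℕ), E (j + 1) = {((n : ℤ) - (j + 1 : ℕ) + l + 1, b)} ∧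
      (n : ℤ) - (j + 1 : ℕ) + l + 1 + b = L ∧ L < n ∧ ∀ x, (abovePoly w (j + 1) 0 L).eval x =
        (1 + x) ^ (j : ℕ) * (1 + w * x) ^ (n - (j + 1)))
    {X : Fin n → K} (hX : ∀ i, X i ≠ 0)
    (hX_one : ∀ i, X i ≠ 1) (hX_ne : ∀ i j, i < j → X i ≠ X j)
    (hX_mul : ∀ i j, i < j → X i * X j ≠ 1) :
    boundedRHS (2 * l + 1) X w = (-1) ^ (n + 1).choose 2 * oddFactor l X w *
      pathCount E X w sign (fun _ => True) := by
  have hfac : oddFactor l X w = ∏ i, ((X i)⁻¹ + 1 + w + X i) * (X i ^ l * (1 + X i)) :=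
    Finset.prod_congr rfl fun i _ => by ring
  rw [hfac]
  -- Here g = x^l (1 + x), since x^(l+n)(x - x⁻¹) = -x^(n-1)(1 - x) · x^l (1 + x).
  refine boundedRHS_eq_of_entries (fun j e he => ?_) hX hX_one hX_ne hX_mul w _ _ ?_
  · obtain ⟨b, L, h1, h2, -⟩ := hE j
    rw [h1, Finset.mem_singleton] at he
    subst he
    simp only; omega
  filter_upwards [Filter.eventually_ge_atTop (n + l + 1)] with N hN r j
  obtain ⟨b, L, h1, h2, h3, h4⟩ := hE j
  have hdeg := (natDegree_abovePoly_le w (j + 1) L).trans_lt h3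
  have key := eval_sub_eval_inv_odd (l := l) (hX r) hdeg j.2
  rw [h4, h4, ← sum_chebS_mul_intCoeff _ hdeg (N := N) _ (by omega) (by omega)] at key
  simp only [levelGF, h1, Finset.sum_singleton, h2, Int.toNat_natCast]
  rw [← mul_assoc, ← mul_assoc] at key
  rw [key]
  congr 1
  obtain ⟨k, hk⟩ : ∃ k, n = k + 1 := ⟨n - 1, by have := r.2; omega⟩
  have := hX r
  rw [show n - 1 = k by omega, show l + n = l + k + 1 by omega, pow_add, pow_add]
  field_simp
  ring

theorem boundedRHS_even_eq {E : ℕ → Finset (ℤ × ℤ)} {l : ℕ} {w : K}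
    (hE : ∀ j : Fin n, ∃ (b : ℤ) (L : ℕ), E (j + 1) = {((n : ℤ) - (j + 1 : ℕ) + l + 1, b),
        ((n : ℤ) - (j + 1 : ℕ) + l, b + 1)} ∧
      (n : ℤ) - (j + 1 : ℕ) + l + 1 + b = L ∧ L < n ∧ ∀ x, (abovePoly w (j + 1) 0 L).eval x =
        (1 + x) ^ (j : ℕ) * (1 + w * x) ^ (n - (j + 1)))
    {X : Fin n → K} (hX : ∀ i, X i ≠ 0)
    (hX_one : ∀ i, X i ≠ 1) (hX_ne : ∀ i j, i < j → X i ≠ X j)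
    (hX_mul : ∀ i j, i < j → X i * X j ≠ 1) :
    boundedRHS (2 * l) X w = (-1) ^ (n + 1).choose 2 * evenFactor l X w *
      pathCount E X w sign (fun _ => True) := by
  have hfac : evenFactor l X w = ∏ i, ((X i)⁻¹ + 1 + w + X i) * X i ^ l :=
    Finset.prod_congr rfl fun i _ => by ring
  rw [hfac]
  refine boundedRHS_eq_of_entries (fun j e he => ?_) hX hX_one hX_ne hX_mul w _ _ ?_
  · obtain ⟨b, L, h1, h2, -⟩ := hE j
    rw [h1, Finset.mem_insert, Finset.mem_singleton] at he
    rcases he with rfl | rfl <;> simp only <;> omega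
  filter_upwards [Filter.eventually_ge_atTop (n + l + 1)] with N hN r j
  obtain ⟨b, L, h1, h2, h3, h4⟩ := hE j
  have hdeg := (natDegree_abovePoly_le w (j + 1) L).trans_lt h3
  have key := eval_sub_eval_inv_even (l := l) (hX r) hdeg j.2
  rw [h4, h4, ← sum_chebS_mul_intCoeff _ hdeg (N := N) _ (by omega) (by omega),
    ← sum_chebS_mul_intCoeff _ hdeg (N := N) _ (by omega) (by omega),
    ← Finset.sum_add_distrib] at key
  have h2' : (n : ℤ) - (j + 1 : ℕ) + l + (b + 1) = L := by omega
  simp only [levelGF, h1]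
  rw [← mul_assoc, ← mul_assoc] at key
  rw [key]
  congr 1
  · obtain ⟨k, hk⟩ : ∃ k, n = k + 1 := ⟨n - 1, by have := r.2; omega⟩
    rw [show n - 1 = k by omega, show l + n - 1 = l + k by omega, pow_add]
    ring
  · refine Finset.sum_congr rfl fun k _ => ?_
    rw [Finset.sum_pair (by simp), h2, h2', Int.toNat_natCast]
    ring

end

/-! ### Splitting and grafting paths -/

/-- The part of a path strictly before the point `P`. -/
def pathBefore (P : ℤ × ℤ) (p : List (ℤ × ℤ)) : List (ℤ × ℤ) := p.takeWhile (· ≠ P)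

/-- The part of a path from the point `P` on. -/
def pathFrom (P : ℤ × ℤ) (p : List (ℤ × ℤ)) : List (ℤ × ℤ) := p.dropWhile (· ≠ P)

theorem pathBefore_append_pathFrom (P : ℤ × ℤ) (p : List (ℤ × ℤ)) :
    pathBefore P p ++ pathFrom P p = p := List.takeWhile_append_dropWhile

theorem notMem_pathBefore (P : ℤ × ℤ) (p : List (ℤ × ℤ)) : P ∉ pathBefore P p := fun h => by
  simpa using List.mem_takeWhile_imp h

theorem pathBefore_append {P : ℤ × ℤ} {a : List (ℤ × ℤ)} (ha : P ∉ a) (t : List (ℤ × ℤ)) :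
    pathBefore P (a ++ P :: t) = a := by
  rw [pathBefore, List.takeWhile_append_of_pos]
  · simp
  · intro x hx
    simpa using fun h : x = P => ha (h ▸ hx)

theorem pathFrom_append {P : ℤ × ℤ} {a : List (ℤ × ℤ)} (ha : P ∉ a) (t : List (ℤ × ℤ)) :
    pathFrom P (a ++ P :: t) = P :: t := by
  have h := pathBefore_append_pathFrom P (a ++ P :: t)
  rw [pathBefore_append ha] at h
  exact List.append_cancel_left h

theorem pathFrom_of_mem {P : ℤ × ℤ} {p : List (ℤ × ℤ)} (h : P ∈ p) :
    ∃ t, pathFrom P p = P :: t := by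
  obtain ⟨a, t, rfl, ha⟩ := List.eq_append_cons_of_mem h
  exact ⟨t, pathFrom_append ha t⟩

theorem pathBefore_of_notMem {P : ℤ × ℤ} {p : List (ℤ × ℤ)} (h : P ∉ p) : pathBefore P p = p :=
  List.takeWhile_eq_self_iff.2 fun x hx => by simpa using fun e : x = P => h (e ▸ hx)

theorem pathFrom_of_notMem {P : ℤ × ℤ} {p : List (ℤ × ℤ)} (h : P ∉ p) : pathFrom P p = [] :=
  List.dropWhile_eq_nil_iff.2 fun x hx => by simpa using fun e : x = P => h (e ▸ hx)

theorem mem_pathFrom {P : ℤ × ℤ} {p : List (ℤ × ℤ)} : P ∈ pathFrom P p ↔ P ∈ p := by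
  refine ⟨fun h => List.dropWhile_subset _ h, fun h => ?_⟩
  obtain ⟨t, ht⟩ := pathFrom_of_mem h
  simp [ht]

/-- The path that follows `p` up to the point `P` and then `q`. -/
def graft (P : ℤ × ℤ) (p q : List (ℤ × ℤ)) : List (ℤ × ℤ) := pathBefore P p ++ pathFrom P q

theorem graft_self (P : ℤ × ℤ) (p : List (ℤ × ℤ)) : graft P p p = p :=
  pathBefore_append_pathFrom P p

theorem pathBefore_graft (P : ℤ × ℤ) (p q : List (ℤ × ℤ)) :
    pathBefore P (graft P p q) = pathBefore P p := by
  by_cases h : P ∈ q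
  · obtain ⟨t, ht⟩ := pathFrom_of_mem h
    rw [graft, ht, pathBefore_append (notMem_pathBefore P p)]
  · rw [graft, pathFrom_of_notMem h, List.append_nil,
      pathBefore_of_notMem (notMem_pathBefore P p)]

theorem pathFrom_graft (P : ℤ × ℤ) (p q : List (ℤ × ℤ)) :
    pathFrom P (graft P p q) = pathFrom P q := by
  by_cases h : P ∈ q
  · obtain ⟨t, ht⟩ := pathFrom_of_mem h
    rw [graft, ht, pathFrom_append (notMem_pathBefore P p)]
  · rw [graft, pathFrom_of_notMem h, List.append_nil,
      pathFrom_of_notMem (notMem_pathBefore P p)]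

theorem mem_graft {P : ℤ × ℤ} {p q : List (ℤ × ℤ)} : P ∈ graft P p q ↔ P ∈ q := by
  rw [graft, List.mem_append, mem_pathFrom]
  simp [notMem_pathBefore]

theorem isLatticePath_append {c : Bool} {s e P : ℤ × ℤ} {a t : List (ℤ × ℤ)} :
    IsLatticePath c s e (a ++ P :: t) ↔
      IsLatticePath c s P (a ++ [P]) ∧ IsLatticePath c P e (P :: t) := by
  have h1 : (a ++ P :: t).head? = (a ++ [P]).head? := by cases a <;> simp
  have h2 : (a ++ P :: t).getLast? = (P :: t).getLast? := by
    rw [List.getLast?_append]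
    simp [List.getLast?_cons]
  simp only [IsLatticePath, List.isChain_split (l₁ := a) (c := P) (l₂ := t), h1, h2]
  simp
  tauto

theorem IsLatticePath.before {c : Bool} {s e P : ℤ × ℤ} {p : List (ℤ × ℤ)}
    (h : IsLatticePath c s e p) (hP : P ∈ p) : IsLatticePath c s P (pathBefore P p ++ [P]) := by
  obtain ⟨t, ht⟩ := pathFrom_of_mem hP
  rw [← pathBefore_append_pathFrom P p, ht, isLatticePath_append] at h
  exact h.1

theorem IsLatticePath.from {c : Bool} {s e P : ℤ × ℤ} {p : List (ℤ × ℤ)}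
    (h : IsLatticePath c s e p) (hP : P ∈ p) : IsLatticePath c P e (pathFrom P p) := by
  obtain ⟨t, ht⟩ := pathFrom_of_mem hP
  rw [← pathBefore_append_pathFrom P p, ht, isLatticePath_append] at h
  rw [ht]
  exact h.2

theorem IsLatticePath.graft {c : Bool} {s e P : ℤ × ℤ} {p q : List (ℤ × ℤ)}
    (hp : IsLatticePath c s P (pathBefore P p ++ [P])) (hq : P ∈ q)
    (h : IsLatticePath c P e (pathFrom P q)) :
    IsLatticePath c s e (graft P p q) := by
  obtain ⟨t, ht⟩ := pathFrom_of_mem hq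
  rw [LittlewoodPaths.graft, ht, isLatticePath_append]
  rw [ht] at h
  exact ⟨hp, h⟩

theorem IsLatticePath.nodup {c : Bool} {e : ℤ × ℤ} :
    ∀ {p : List (ℤ × ℤ)} {s : ℤ × ℤ}, IsLatticePath c s e p → p.Nodup
  | [], _, _ => List.nodup_nil
  | [a], _, _ => List.nodup_singleton a
  | a :: b :: t, s, h => by
    obtain ⟨rfl, h2, h3⟩ := h.cons_cons
    refine List.nodup_cons.2 ⟨fun ha => ?_, h3.nodup⟩
    have h4 := (h3.before ha).potential_le
    have h5 := h2.potential_lt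
    omega

/-- Paths above the line `x + y = 0` do not depend on the type of the starting point. -/
theorem IsLatticePath.of_pos {c : Bool} (c' : Bool) {e : ℤ × ℤ} :
    ∀ {p : List (ℤ × ℤ)} {s : ℤ × ℤ}, IsLatticePath c s e p → 0 < s.1 + s.2 →
      IsLatticePath c' s e p
  | [], _, h, _ => by simp [IsLatticePath] at h
  | [a], _, h, _ => ⟨h.1, h.2.1, List.isChain_singleton a⟩
  | a :: b :: t, s, h, hs => by
    obtain ⟨rfl, h2, h3⟩ := h.cons_cons
    refine (isLatticePath_iff_cons rfl).2 ⟨?_, h3.of_pos c' (hs.trans_le h2.sum_le)⟩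
    rcases h2 with ⟨h, -, -⟩ | h
    · omega
    · exact Or.inr h

/-- The side of the line `x = y` on which the lower parts of the paths lie. -/
def OnSide (c : Bool) (P : ℤ × ℤ) : Prop := if c then P.1 < P.2 else P.2 < P.1

/-- Below the line, diagonal steps move away from x = y and (1, 1) is parallel to it. -/
theorem IsLatticePath.onSide {c : Bool} {s e : ℤ × ℤ} {p : List (ℤ × ℤ)}
    (h : IsLatticePath c s e p) (hs : OnSide c s) (he : e.1 + e.2 ≤ 0) : OnSide c e := by
  match p, h with
  | [], h => simp [IsLatticePath] at h
  | [a], h =>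
    have h1 : a = s := by simpa using h.1
    have h2 : a = e := by simpa using h.2.1
    rwa [← h2, h1]
  | a :: b :: t, h =>
    obtain ⟨rfl, h2, h3⟩ := h.cons_cons
    refine h3.onSide ?_ he
    have hb := h3.sum_le
    obtain ⟨x, y⟩ := a
    cases c <;> rcases h2 with ⟨-, -, h | h⟩ | ⟨h', h | h⟩ <;> subst h <;>
      simp [OnSide] at * <;> omega

theorem onSide_startPoint (c : Bool) (i : ℕ) : OnSide c (startPoint c (i + 1)) := by
  cases c <;> simp [OnSide, startPoint] <;> omega

section

variable {K : Type*} [Field K] {n : ℕ}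

theorem pathWeight_append (X : Fin n → K) (w : K) (j : ℕ) (P : ℤ × ℤ) (t : List (ℤ × ℤ)) :
    ∀ a : List (ℤ × ℤ), pathWeight X w j (a ++ P :: t) =
      pathWeight X w j (a ++ [P]) * pathWeight X w j (P :: t)
  | [] => by simp [pathWeight]
  | [b] => by
    simp only [List.cons_append, List.nil_append]
    rw [pathWeight_cons X w j b (b := P) (by simp),
      pathWeight_cons X w j b (b := P) (by simp)]
    simp [pathWeight]
  | b :: b' :: a => by
    have ih := pathWeight_append X w j P t (b' :: a)
    simp only [List.cons_append] at ih ⊢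
    rw [pathWeight_cons X w j b (b := b') (by simp),
      pathWeight_cons X w j b (b := b') (by simp), ih, mul_assoc]

/-- The weight of a path does not depend on its endpoint, if the path ends on or below
`x + y = 0` or if `w = 1`. -/
theorem IsLatticePath.pathWeight_eq {c : Bool} {e : ℤ × ℤ} (X : Fin n → K) {w : K} (j j' : ℕ)
    (he : e.1 + e.2 ≤ 0 ∨ w = 1) :
    ∀ {p : List (ℤ × ℤ)} {s : ℤ × ℤ}, IsLatticePath c s e p →
      pathWeight X w j p = pathWeight X w j' p
  | [], _, h => by simp [IsLatticePath] at h
  | [a], _, _ => by simp [pathWeight]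
  | a :: b :: t, s, h => by
    obtain ⟨rfl, h2, h3⟩ := h.cons_cons
    rw [pathWeight_cons X w j a (b := b) rfl, pathWeight_cons X w j' a (b := b) rfl,
      h3.pathWeight_eq X j j' he]
    congr 1
    rcases he with he | rfl
    · have hb := h3.sum_le
      have hne : b ≠ a + (1, 0) := by
        rintro rfl
        rcases h2 with ⟨-, -, h | h⟩ | ⟨h, -⟩
        · simp at h
        · cases c <;> simp at h
        · simp at hb; omega
      simp [stepWeight, hne]
    · simp [stepWeight]

/-! ### Exchanging the tails of two paths -/

variable {E : ℕ → Finset (ℤ × ℤ)}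

/-- The tails of the paths `i` and `j` from the common point `P` on can be exchanged. -/
structure Exchangeable (F : PathFamily n E) (P : ℤ × ℤ) (i j : Fin n) : Prop where
  ne : i ≠ j
  mem_left : P ∈ F.path i
  mem_right : P ∈ F.path j
  compatible : F.start i = F.start j ∨ 0 < P.1 + P.2

theorem Exchangeable.swap_apply {F : PathFamily n E} {P : ℤ × ℤ} {i j : Fin n}
    (h : Exchangeable F P i j) (k : Fin n) :
    Equiv.swap i j k = k ∨ (P ∈ F.path k ∧ P ∈ F.path (Equiv.swap i j k) ∧
      (F.start k = F.start (Equiv.swap i j k) ∨ 0 < P.1 + P.2)) := by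
  by_cases hi : k = i
  · subst hi
    right
    rw [Equiv.swap_apply_left]
    exact ⟨h.2, h.3, h.4⟩
  by_cases hj : k = j
  · subst hj
    right
    rw [Equiv.swap_apply_right]
    exact ⟨h.3, h.2, h.4.imp_left Eq.symm⟩
  exact Or.inl (Equiv.swap_apply_of_ne_of_ne hi hj)

open Classical in
/-- The family with the tails of the paths `i` and `j` from `P` on exchanged. -/
noncomputable def exchange (F : PathFamily n E) (P : ℤ × ℤ) (i j : Fin n) : PathFamily n E :=
  if h : Exchangeable F P i j then
    { perm := F.perm * Equiv.swap i j
      start := F.start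
      path := fun k => graft P (F.path k) (F.path (Equiv.swap i j k))
      isPath := fun k => by
        rcases h.swap_apply k with hk | ⟨h1, h2, h3⟩
        · rw [Equiv.Perm.mul_apply, hk, graft_self]
          exact F.isPath k
        · obtain ⟨e, he, hp⟩ := F.isPath k
          obtain ⟨e', he', hp'⟩ := F.isPath (Equiv.swap i j k)
          refine ⟨e', he', IsLatticePath.graft (hp.before h1) h2 ?_⟩
          rcases h3 with h3 | h3
          · rw [h3]; exact hp'.from h2
          · exact (hp'.from h2).of_pos _ h3 }
  else F

theorem exchange_perm {F : PathFamily n E} {P : ℤ × ℤ} {i j : Fin n}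
    (h : Exchangeable F P i j) : (exchange F P i j).perm = F.perm * Equiv.swap i j := by
  rw [exchange, dif_pos h]

theorem exchange_start {F : PathFamily n E} {P : ℤ × ℤ} {i j : Fin n}
    (h : Exchangeable F P i j) : (exchange F P i j).start = F.start := by
  rw [exchange, dif_pos h]

theorem exchange_path {F : PathFamily n E} {P : ℤ × ℤ} {i j : Fin n}
    (h : Exchangeable F P i j) (k : Fin n) :
    (exchange F P i j).path k = graft P (F.path k) (F.path (Equiv.swap i j k)) := by
  rw [exchange, dif_pos h]

theorem mem_exchange_path {F : PathFamily n E} {P : ℤ × ℤ} {i j : Fin n}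
    (h : Exchangeable F P i j) (k : Fin n) :
    P ∈ (exchange F P i j).path k ↔ P ∈ F.path k := by
  rw [exchange_path h, mem_graft]
  rcases h.swap_apply k with hk | ⟨h1, h2, -⟩
  · rw [hk]
  · exact iff_of_true h2 h1

theorem exchangeable_exchange {F : PathFamily n E} {P : ℤ × ℤ} {i j : Fin n}
    (h : Exchangeable F P i j) : Exchangeable (exchange F P i j) P i j :=
  ⟨h.1, (mem_exchange_path h i).2 h.2, (mem_exchange_path h j).2 h.3,
    by rw [exchange_start h]; exact h.4⟩

theorem exchange_exchange {F : PathFamily n E} {P : ℤ × ℤ} {i j : Fin n}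
    (h : Exchangeable F P i j) : exchange (exchange F P i j) P i j = F := by
  have h' := exchangeable_exchange h
  refine PathFamily.ext ?_ ?_ (funext fun k => ?_)
  · rw [exchange_perm h', exchange_perm h, mul_assoc, Equiv.swap_mul_self, mul_one]
  · rw [exchange_start h', exchange_start h]
  · rw [exchange_path h', graft, exchange_path h, exchange_path h, pathBefore_graft,
      pathFrom_graft, ← Equiv.Perm.mul_apply, Equiv.swap_mul_self, Equiv.Perm.one_apply, pathBefore_append_pathFrom]

theorem sign_exchange {F : PathFamily n E} {P : ℤ × ℤ} {i j : Fin n}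
    (h : Exchangeable F P i j) : (exchange F P i j).sign = -F.sign := by
  simp [PathFamily.sign, exchange_perm h, exchange_start h, Equiv.Perm.sign_swap h.ne]

theorem weight_exchange {F : PathFamily n E} {P : ℤ × ℤ} {i j : Fin n}
    (h : Exchangeable F P i j) (X : Fin n → K) {w : K} (hP : P.1 + P.2 ≤ 0 ∨ w = 1) :
    (exchange F P i j).weight X w = F.weight X w := by
  classical
  -- `A` collects heads and `B` tails, so the exchange only permutes the factors `B`. The end index
  -- 0 in `A` is arbitrary: by `hP` the weight of a head does not depend on it.
  let A : Fin n → K := fun k =>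
    if P ∈ F.path k then pathWeight X w 0 (pathBefore P (F.path k) ++ [P]) else 1
  let B : Fin n → K := fun k =>
    if P ∈ F.path k then pathWeight X w ((F.perm k : ℕ) + 1) (pathFrom P (F.path k))
    else pathWeight X w ((F.perm k : ℕ) + 1) (F.path k)
  have key : ∀ k k', (k = k' ∨ (P ∈ F.path k ∧ P ∈ F.path k')) →
      pathWeight X w ((F.perm k' : ℕ) + 1) (graft P (F.path k) (F.path k')) = A k * B k' := by
    intro k k' hk
    by_cases h1 : P ∈ F.path k
    · have h2 : P ∈ F.path k' := hk.elim (fun h => h ▸ h1) fun h => h.2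
      obtain ⟨e, -, hp⟩ := F.isPath k
      simp only [A, B, h1, h2, if_true]
      obtain ⟨t, ht⟩ := pathFrom_of_mem h2
      rw [graft, ht, pathWeight_append, (hp.before h1).pathWeight_eq X _ 0 hP]
    · obtain rfl : k = k' := hk.elim id fun h => absurd h.1 h1
      simp only [A, B, h1, if_false, graft_self, one_mul]
  have h1 : F.weight X w = ∏ k, A k * B k := by
    refine Finset.prod_congr rfl fun k _ => ?_
    rw [← key k k (Or.inl rfl), graft_self]
  have h2 : (exchange F P i j).weight X w = ∏ k, A k * B (Equiv.swap i j k) := by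
    refine Finset.prod_congr rfl fun k _ => ?_
    rw [exchange_path h, exchange_perm h, Equiv.Perm.mul_apply]
    exact key k _ ((h.swap_apply k).imp Eq.symm fun h => ⟨h.1, h.2.1⟩)
  rw [h1, h2, Finset.prod_mul_distrib, Finset.prod_mul_distrib, Equiv.prod_comp]

/-- The exchange preserves the multiset of visited points, so an exchange point chosen from it alone
is unchanged afterwards. -/
theorem sum_count_exchange {F : PathFamily n E} {P : ℤ × ℤ} {i j : Fin n}
    (h : Exchangeable F P i j) (Q : ℤ × ℤ) :
    ∑ k, ((exchange F P i j).path k).count Q = ∑ k, (F.path k).count Q := by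
  have h1 : ∀ k, (F.path k).count Q =
      (pathBefore P (F.path k)).count Q + (pathFrom P (F.path k)).count Q := fun k => by
    rw [← List.count_append, pathBefore_append_pathFrom]
  simp only [exchange_path h, graft, List.count_append, h1, Finset.sum_add_distrib]
  rw [Equiv.sum_comp (Equiv.swap i j) fun k => (pathFrom P (F.path k)).count Q]

theorem one_lt_sum_count {F : PathFamily n E} {Q : ℤ × ℤ} :
    1 < ∑ k, (F.path k).count Q ↔ ∃ i j, i ≠ j ∧ Q ∈ F.path i ∧ Q ∈ F.path j := by
  classical
  have h : ∀ k, (F.path k).count Q = if Q ∈ F.path k then 1 else 0 := fun k => by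
    obtain ⟨e, -, hp⟩ := F.isPath k
    exact hp.nodup.count
  simp only [h, Finset.sum_boole, Nat.cast_id]
  rw [Finset.one_lt_card]
  simp only [Finset.mem_filter, Finset.mem_univ, true_and]
  constructor
  · rintro ⟨i, hi, j, hj, hij⟩
    exact ⟨i, j, hij, hi, hj⟩
  · rintro ⟨i, j, hij, hi, hj⟩
    exact ⟨i, hi, j, hj, hij⟩

/-- On or below x+y=0 the two kinds of paths lie strictly on opposite sides of x = y, so paths
meeting there have the same step set. Above the line all step sets coincide. -/
theorem exchangeable_of_mem {F : PathFamily n E} {P : ℤ × ℤ} {i j : Fin n} (hij : i ≠ j)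
    (hi : P ∈ F.path i) (hj : P ∈ F.path j) : Exchangeable F P i j := by
  refine ⟨hij, hi, hj, or_iff_not_imp_right.2 fun hP => ?_⟩
  have hP : P.1 + P.2 ≤ 0 := not_lt.1 hP
  have key : ∀ k, P ∈ F.path k → OnSide (F.start k) P := fun k hk => by
    obtain ⟨e, -, hp⟩ := F.isPath k
    exact (hp.before hk).onSide (onSide_startPoint _ _) hP
  have h1 := key i hi
  have h2 := key j hj
  cases h3 : F.start i <;> cases h4 : F.start j <;> simp [h3, h4, OnSide] at * <;> omega

/-! ### Cancellation of the families with a shared point -/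

/-- No two paths of the family share a point satisfying `T`. -/
def NonIntersectingAt (T : ℤ × ℤ → Prop) (F : PathFamily n E) : Prop :=
  ∀ i j, i ≠ j → ∀ P, T P → P ∈ F.path i → P ∉ F.path j

open Classical in
theorem pathCount_eq_of_sum_eq_zero {X : Fin n → K} {w : K} {sgn : PathFamily n E → ℤ}
    {good : PathFamily n E → Prop}
    (h : ∑ F : PathFamily n E with ¬ good F, (sgn F : K) * F.weight X w = 0) :
    pathCount E X w sgn (fun _ => True) = pathCount E X w sgn good := by
  have hall : pathCount E X w sgn (fun _ => True) =
      ∑ F : PathFamily n E, (sgn F : K) * F.weight X w := by simp [pathCount]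
  rw [hall, pathCount, ← Finset.sum_filter_add_sum_filter_not Finset.univ good, h, add_zero]

/-- The families in which two paths share a point satisfying `T` cancel. -/
theorem pathCount_eq_of_imp (E : ℕ → Finset (ℤ × ℤ)) (X : Fin n → K) {w : K}
    {T : ℤ × ℤ → Prop} (hT : ∀ P, T P → P.1 + P.2 ≤ 0 ∨ w = 1) :
    pathCount E X w sign (fun _ => True) = pathCount E X w sign (NonIntersectingAt T) := by
  classical
  refine pathCount_eq_of_sum_eq_zero ?_
  rcases isEmpty_or_nonempty (Fin n) with hn | hn
  · refine Finset.sum_eq_zero fun F hF => absurd (fun i => isEmptyElim i) (Finset.mem_filter.1 hF).2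
  -- The point and the pair of paths are chosen as functions of sets that the exchange preserves:
  -- the multiply visited points satisfying `T`, and the paths through the chosen point. Hence
  -- repeating the exchange undoes it.
  obtain ⟨ψ, hψ⟩ : ∃ ψ : Set (ℤ × ℤ) → ℤ × ℤ, ∀ S, S.Nonempty → ψ S ∈ S :=
    ⟨fun S => Classical.epsilon (· ∈ S), fun S h => Classical.epsilon_spec h⟩
  obtain ⟨φ, hφ⟩ : ∃ φ : Set (Fin n) → Fin n × Fin n, ∀ S, S.Nontrivial →
      (φ S).1 ∈ S ∧ (φ S).2 ∈ S ∧ (φ S).1 ≠ (φ S).2 :=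
    ⟨fun S => Classical.epsilon fun x => x.1 ∈ S ∧ x.2 ∈ S ∧ x.1 ≠ x.2, fun S h =>
      Classical.epsilon_spec (p := fun x : Fin n × Fin n => x.1 ∈ S ∧ x.2 ∈ S ∧ x.1 ≠ x.2)
        (by obtain ⟨i, hi, j, hj, hij⟩ := h; exact ⟨(i, j), hi, hj, hij⟩)⟩
  let P : PathFamily n E → ℤ × ℤ := fun F => ψ {Q | T Q ∧ 1 < ∑ k, (F.path k).count Q}
  let x : PathFamily n E → Fin n × Fin n := fun F => φ {k | P F ∈ F.path k}
  have hex : ∀ F, ¬ NonIntersectingAt T F →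
      T (P F) ∧ Exchangeable F (P F) (x F).1 (x F).2 := by
    intro F hF
    unfold NonIntersectingAt at hF
    push Not at hF
    obtain ⟨i, j, hij, Q, hQ, hi, hj⟩ := hF
    obtain ⟨h1, h2⟩ := hψ {Q | T Q ∧ 1 < ∑ k, (F.path k).count Q}
      ⟨Q, hQ, one_lt_sum_count.2 ⟨i, j, hij, hi, hj⟩⟩
    obtain ⟨i', j', hij', hi', hj'⟩ := one_lt_sum_count.1 h2
    obtain ⟨h3, h4, h5⟩ := hφ {k | P F ∈ F.path k} ⟨i', hi', j', hj', hij'⟩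
    exact ⟨h1, exchangeable_of_mem h5 h3 h4⟩
  have hP : ∀ F, Exchangeable F (P F) (x F).1 (x F).2 →
      P (exchange F (P F) (x F).1 (x F).2) = P F := fun F h => by
    simp only [P, sum_count_exchange h]
  have hx : ∀ F, Exchangeable F (P F) (x F).1 (x F).2 →
      x (exchange F (P F) (x F).1 (x F).2) = x F := fun F h => by
    have h1 : {k | P F ∈ (exchange F (P F) (x F).1 (x F).2).path k} = {k | P F ∈ F.path k} :=
      Set.ext fun k => mem_exchange_path h k
    change φ _ = φ _
    rw [hP F h, h1]
  refine Finset.sum_involution (fun F _ => exchange F (P F) (x F).1 (x F).2) ?_ ?_ ?_ ?_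
  · intro F hF
    obtain ⟨h1, h2⟩ := hex F (Finset.mem_filter.1 hF).2
    rw [sign_exchange h2, weight_exchange h2 X (hT _ h1)]
    push_cast
    ring
  · intro F hF _ heq
    obtain ⟨h1, h2⟩ := hex F (Finset.mem_filter.1 hF).2
    have h3 := exchange_perm h2
    rw [heq, left_eq_mul, Equiv.swap_eq_one_iff] at h3
    exact h2.ne h3
  · intro F hF
    obtain ⟨h1, h2⟩ := hex F (Finset.mem_filter.1 hF).2
    have h3 := exchangeable_exchange h2
    exact Finset.mem_filter.2 ⟨Finset.mem_univ _, fun h => h _ _ h3.ne _ h1 h3.mem_left h3.mem_right⟩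
  · intro F hF
    obtain ⟨h1, h2⟩ := hex F (Finset.mem_filter.1 hF).2
    simp only [hP F h2, hx F h2]
    exact exchange_exchange h2

end

/-! ### Order of the endpoints of non-intersecting paths -/

/-- Along a path starting on or above `x + y = 0` that has left this line, the first coordinate
does not decrease. -/
theorem IsLatticePath.fst_le {c : Bool} {e : ℤ × ℤ} :
    ∀ {p : List (ℤ × ℤ)} {s : ℤ × ℤ}, IsLatticePath c s e p → 0 < s.1 + s.2 → s.1 ≤ e.1
  | [], _, h, _ => by simp [IsLatticePath] at h
  | [a], s, h, _ => by
    have h1 : a = s := by simpa using h.1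
    have h2 : a = e := by simpa using h.2.1
    rw [← h1, h2]
  | a :: b :: t, s, h, hs => by
    obtain ⟨rfl, h2, h3⟩ := h.cons_cons
    have h4 := h3.fst_le (hs.trans_le h2.sum_le)
    rcases h2 with ⟨h5, -, -⟩ | ⟨-, h5 | h5⟩
    · omega
    · rw [h5] at h4; simp at h4; omega
    · rw [h5] at h4; simpa using h4

/-- A step stays on its diagonal, or it goes two diagonals up below `x + y = 0`, or it is one of
the steps above this line. -/
theorem IsStep.cases {c : Bool} {P Q : ℤ × ℤ} (h : IsStep c P Q) :
    (P.1 + P.2 ≤ 0 ∧ Q.1 + Q.2 = P.1 + P.2 ∧ (Q.1 = P.1 - 1 ∨ Q.1 = P.1 + 1)) ∨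
      (P.1 + P.2 ≤ -2 ∧ Q.1 + Q.2 = P.1 + P.2 + 2 ∧ Q.1 = P.1 + 1) ∨
      (0 ≤ P.1 + P.2 ∧ Q.1 + Q.2 = P.1 + P.2 + 1 ∧ P.1 ≤ Q.1 ∧ Q.1 ≤ P.1 + 1) := by
  obtain ⟨x, y⟩ := P
  cases c <;> rcases h with ⟨h1, h2, h | h⟩ | ⟨h1, h | h⟩ <;> subst h <;> simp at * <;> omega

/-- Two paths of which one starts to the left and ends to the right of the other have a point in
common. -/
theorem IsLatticePath.exists_mem_of_crossing {c c' : Bool} {e e' : ℤ × ℤ}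
    (h1 : e'.1 + e'.2 ≤ e.1 + e.2) (h2 : e.1 ≤ e'.1) (h3 : 0 ≤ e'.1 + e'.2) (k : ℕ) :
    ∀ {p q : List (ℤ × ℤ)} {s s' : ℤ × ℤ}, p.length + q.length = k →
      IsLatticePath c s e p → IsLatticePath c' s' e' q → s.1 + s.2 = s'.1 + s'.2 →
      s'.1 ≤ s.1 → ∃ P ∈ p, P ∈ q := by
  induction k using Nat.strong_induction_on with
  | _ k ih =>
    intro p q s s' hk hp hq hs hss
    have hsp : s ∈ p := List.mem_of_head? hp.1
    have hsq : s' ∈ q := List.mem_of_head? hq.1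
    rcases hss.eq_or_lt with heq | hlt
    · have : s' = s := Prod.ext heq (by omega)
      exact ⟨s, hsp, this ▸ hsq⟩
    have hle := hp.sum_le
    have hle' := hq.sum_le
    match p, hp, q, hq with
    | [], hp, _, _ => simp [IsLatticePath] at hp
    | _, _, [], hq => simp [IsLatticePath] at hq
    | [a], hp, [b], hq =>
      have g1 : a = s := by simpa using hp.1
      have g2 : a = e := by simpa using hp.2.1
      have g3 : b = s' := by simpa using hq.1
      have g4 : b = e' := by simpa using hq.2.1
      subst g1 g2 g3 g4
      omega
    | [a], hp, b :: b' :: q, hq =>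
      have g1 : a = s := by simpa using hp.1
      have g2 : a = e := by simpa using hp.2.1
      subst g1 g2
      obtain ⟨rfl, h4, h5⟩ := hq.cons_cons
      have h6 := h5.sum_le
      rcases h4.cases with h7 | h7 | h7
      · obtain ⟨P, hP1, hP2⟩ := ih _ (by simp at hk ⊢; omega) rfl hp h5 (by omega) (by omega)
        exact ⟨P, hP1, List.mem_cons_of_mem _ hP2⟩
      · omega
      · omega
    | a :: a' :: p, hp, [b], hq =>
      have g1 : b = s' := by simpa using hq.1
      have g2 : b = e' := by simpa using hq.2.1
      subst g1 g2
      obtain ⟨rfl, h4, h5⟩ := hp.cons_cons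
      rcases h4.cases with h7 | h7 | h7
      · obtain ⟨P, hP1, hP2⟩ := ih _ (by simp at hk ⊢; omega) rfl h5 hq (by omega) (by omega)
        exact ⟨P, List.mem_cons_of_mem _ hP1, hP2⟩
      · omega
      · have := h5.fst_le (by omega)
        omega
    | a :: a' :: p, hp, b :: b' :: q, hq =>
      obtain ⟨rfl, h4, h5⟩ := hp.cons_cons
      obtain ⟨rfl, h4', h5'⟩ := hq.cons_cons
      -- Steps along a diagonal are taken one path at a time: they change the first coordinate by 1,
      -- so a strict order turns at worst into equality.
      rcases h4.cases with h7 | h7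
      · obtain ⟨P, hP1, hP2⟩ := ih _ (by simp at hk ⊢; omega) rfl h5 hq (by omega) (by omega)
        exact ⟨P, List.mem_cons_of_mem _ hP1, hP2⟩
      rcases h4'.cases with h7' | h7'
      · obtain ⟨P, hP1, hP2⟩ := ih _ (by simp at hk ⊢; omega) rfl hp h5' (by omega) (by omega)
        exact ⟨P, hP1, List.mem_cons_of_mem _ hP2⟩
      -- Both paths leave the diagonal: below the line the gap is kept, from the line on it shrinks
      -- by at most 1.
      obtain ⟨P, hP1, hP2⟩ := ih _ (by simp at hk ⊢; omega) rfl h5 h5' (by omega) (by omega)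
      exact ⟨P, List.mem_cons_of_mem _ hP1, List.mem_cons_of_mem _ hP2⟩

/-- A path that starts below the diagonal `x + y = -2 d` contains a path that starts on this
diagonal. -/
theorem IsLatticePath.exists_suffix {c : Bool} {e : ℤ × ℤ} (d : ℕ) (he : 0 ≤ e.1 + e.2) :
    ∀ {p : List (ℤ × ℤ)} {s : ℤ × ℤ}, IsLatticePath c s e p → ∀ k : ℕ,
      s.1 + s.2 = -2 * (d + k) → ∃ r q, IsLatticePath c r e q ∧ q ⊆ p ∧ r.1 + r.2 = -2 * d ∧
        if c then r.1 - r.2 ≤ s.1 - s.2 else s.1 - s.2 ≤ r.1 - r.2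
  | [], _, h, _, _ => by simp [IsLatticePath] at h
  | p, s, h, 0, hs => ⟨s, p, h, List.Subset.refl p, by simpa using hs, by cases c <;> simp⟩
  | [a], s, h, k + 1, hs => by
    have h1 : a = s := by simpa using h.1
    have h2 : a = e := by simpa using h.2.1
    subst h1 h2
    push_cast at hs
    omega
  | a :: b :: t, s, h, k + 1, hs => by
    obtain ⟨rfl, h2, h3⟩ := h.cons_cons
    push_cast at hs
    have h4 : (b.1 + b.2 = -2 * (d + k) ∨ b.1 + b.2 = -2 * (d + (k + 1 : ℕ))) ∧
        if c then b.1 - b.2 ≤ a.1 - a.2 else a.1 - a.2 ≤ b.1 - b.2 := by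
      obtain ⟨x, y⟩ := a
      cases c <;> rcases h2 with ⟨-, -, h | h⟩ | ⟨h', h | h⟩ <;> subst h <;> simp at * <;> omega
    obtain ⟨h4, h5⟩ := h4
    have key : ∃ r q, IsLatticePath c r e q ∧ q ⊆ b :: t ∧ r.1 + r.2 = -2 * d ∧
        if c then r.1 - r.2 ≤ b.1 - b.2 else b.1 - b.2 ≤ r.1 - r.2 :=
      h4.elim (h3.exists_suffix d he k) (h3.exists_suffix d he (k + 1))
    obtain ⟨r, q, h6, h7, h8, h9⟩ := key
    refine ⟨r, q, h6, List.subset_cons_of_subset a h7, h8, ?_⟩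
    cases c <;> simp only [if_true, Bool.false_eq_true, if_false] at * <;> omega

section

variable {n : ℕ} {E : ℕ → Finset (ℤ × ℤ)}

/-- A path starting in `A_{i+1}` restricted to the region above the diagonal `x + y = -2 d`. -/
theorem PathFamily.exists_suffix (F : PathFamily n E)
    (hE : ∀ j : Fin n, ∀ e ∈ E (j + 1), 0 ≤ e.1 + e.2) (i : Fin n) {d : ℕ} (hd : d ≤ 2 * i + 1) :
    ∃ e ∈ E (F.perm i + 1), ∃ r q, IsLatticePath (F.start i) r e q ∧ q ⊆ F.path i ∧
      r.1 + r.2 = -2 * d ∧ if F.start i then r.1 - r.2 ≤ -2 * (i + 1) else 2 * (i + 1) ≤ r.1 - r.2 := by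
  obtain ⟨e, he, hp⟩ := F.isPath i
  obtain ⟨r, q, h1, h2, h3, h4⟩ := hp.exists_suffix d (hE _ e he) (2 * i + 1 - d) (by
    cases F.start i <;> simp only [startPoint, if_true, Bool.false_eq_true, if_false] <;> omega)
  refine ⟨e, he, r, q, h1, h2, h3, ?_⟩
  cases hs : F.start i <;>
    simp only [hs, startPoint, if_true, Bool.false_eq_true, if_false] at h4 ⊢ <;> omega

/-- In a non-intersecting family, paths starting further to the left have larger end index. -/
theorem PathFamily.NonIntersecting.perm_lt {F : PathFamily n E} (hF : F.NonIntersecting)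
    (hE : ∀ j : Fin n, ∀ e ∈ E (j + 1), 0 ≤ e.1 + e.2)
    (hE' : ∀ j j' : Fin n, j' < j → ∀ e ∈ E (j + 1), ∀ e' ∈ E (j' + 1),
      e'.1 + e'.2 ≤ e.1 + e.2 ∧ e.1 ≤ e'.1) {i i' : Fin n} (hii : i ≠ i')
    {e e' r r' : ℤ × ℤ} {q q' : List (ℤ × ℤ)} (he : e ∈ E (F.perm i + 1))
    (he' : e' ∈ E (F.perm i' + 1)) (hq : IsLatticePath (F.start i) r e q)
    (hq' : IsLatticePath (F.start i') r' e' q') (hqp : q ⊆ F.path i) (hqp' : q' ⊆ F.path i')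
    (hr : r.1 + r.2 = r'.1 + r'.2) (hrr : r'.1 ≤ r.1) : F.perm i < F.perm i' := by
  by_contra hlt
  have hlt : F.perm i' < F.perm i :=
    lt_of_le_of_ne (not_lt.1 hlt) fun h => hii (F.perm.injective h).symm
  obtain ⟨h1, h2⟩ := hE' _ _ hlt e he e' he'
  obtain ⟨P, hP, hP'⟩ := hq.exists_mem_of_crossing h1 h2 (hE _ e' he') _ rfl hq' hr hrr
  exact hF i i' hii P (hqp hP) (hqp' hP')

/-- Paths of the same kind are compared on the diagonal where path `i` starts: the deeper path `i'`
arrives there farther from x = y. Paths of different kinds are compared on x+y=0. Either way `start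
i'` decides which path is on the left. -/
theorem PathFamily.NonIntersecting.perm_lt_iff {F : PathFamily n E} (hF : F.NonIntersecting)
    (hE : ∀ j : Fin n, ∀ e ∈ E (j + 1), 0 ≤ e.1 + e.2)
    (hE' : ∀ j j' : Fin n, j' < j → ∀ e ∈ E (j + 1), ∀ e' ∈ E (j' + 1),
      e'.1 + e'.2 ≤ e.1 + e.2 ∧ e.1 ≤ e'.1) {i i' : Fin n} (hii : i < i') :
    F.perm i < F.perm i' ↔ F.start i' = true := by
  have hii' : (i : ℕ) < i' := hii
  by_cases hs : F.start i = F.start i'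
  · obtain ⟨e, he, hp⟩ := F.isPath i
    obtain ⟨e', he', r', q', h1', h2', h3', h4'⟩ :=
      F.exists_suffix hE i' (d := 2 * i + 1) (by omega)
    cases hc : F.start i'
    · simp only [Bool.false_eq_true, iff_false, not_lt]
      simp only [hc, Bool.false_eq_true, if_false] at h4'
      rw [hc] at hs
      refine (hF.perm_lt hE hE' hii.ne' he' he h1' hp h2' (List.Subset.refl _) ?_ ?_).le
      · simp only [hs, startPoint, Bool.false_eq_true, if_false]; push_cast at h3' ⊢; omega
      · simp only [hs, startPoint, Bool.false_eq_true, if_false]; push_cast at h3' ⊢; omega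
    · simp only [iff_true]
      simp only [hc, if_true] at h4'
      rw [hc] at hs
      refine hF.perm_lt hE hE' hii.ne he he' hp h1' (List.Subset.refl _) h2' ?_ ?_
      · simp only [hs, startPoint, if_true]; push_cast at h3' ⊢; omega
      · simp only [hs, startPoint, if_true]; push_cast at h3' ⊢; omega
  · obtain ⟨e, he, r, q, h1, h2, h3, h4⟩ := F.exists_suffix hE i (d := 0) (by omega)
    obtain ⟨e', he', r', q', h1', h2', h3', h4'⟩ := F.exists_suffix hE i' (d := 0) (by omega)
    cases hc : F.start i'
    · have hc' : F.start i = true := by simpa [hc] using hs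
      simp only [Bool.false_eq_true, iff_false, not_lt]
      simp only [hc, hc', Bool.false_eq_true, if_true, if_false] at h4 h4'
      exact (hF.perm_lt hE hE' hii.ne' he' he h1' h1 h2' h2 (by omega) (by omega)).le
    · have hc' : F.start i = false := by simpa [hc] using hs
      simp only [iff_true]
      simp only [hc, hc', Bool.false_eq_true, if_true, if_false] at h4 h4'
      exact hF.perm_lt hE hE' hii.ne he he' h1 h1' h2 h2' (by omega) (by omega)

/-- By `perm_lt_iff`, the index `i` forms inversions with all `i` smaller indices or with none,
according to `start i`, so the sign is a product of local factors. -/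
theorem PathFamily.NonIntersecting.sign_eq {F : PathFamily n E} (hF : F.NonIntersecting)
    (hE : ∀ j : Fin n, ∀ e ∈ E (j + 1), 0 ≤ e.1 + e.2)
    (hE' : ∀ j j' : Fin n, j' < j → ∀ e ∈ E (j + 1), ∀ e' ∈ E (j' + 1),
      e'.1 + e'.2 ≤ e.1 + e.2 ∧ e.1 ≤ e'.1) :
    (-1) ^ (n + 1).choose 2 * F.sign = F.indexSign := by
  have h1 : (Equiv.Perm.sign F.perm : ℤ) =
      ∏ i : Fin n, if F.start i then 1 else (-1) ^ (i : ℕ) := by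
    rw [Equiv.Perm.sign_eq_prod_prod_Iio]
    push_cast
    refine Finset.prod_congr rfl fun j _ => ?_
    rw [Finset.prod_congr rfl (g := fun _ => if F.start j then (1 : ℤ) else -1)]
    · rw [Finset.prod_const, Fin.card_Iio]
      split_ifs <;> simp
    · intro i hi
      have h := hF.perm_lt_iff hE hE' (Finset.mem_Iio.1 hi)
      simp only [h]
      split_ifs <;> rfl
  have h2 : ((-1 : ℤ)) ^ (n + 1).choose 2 = ∏ i : Fin n, (-1) ^ ((i : ℕ) + 1) := by
    have h3 := Finset.sum_range_succ' (fun i => i) n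
    rw [Finset.sum_range_id, ← Nat.choose_two_right, add_zero] at h3
    rw [Finset.prod_pow_eq_pow_sum, Fin.sum_univ_eq_sum_range (fun i => i + 1), h3]
  rw [PathFamily.sign, PathFamily.indexSign, h1, h2, ← Finset.prod_pow_eq_pow_sum,
    ← Finset.prod_mul_distrib, ← Finset.prod_mul_distrib]
  refine Finset.prod_congr rfl fun i _ => ?_
  split_ifs
  · simp
  · rw [pow_succ]
    have : (-1 : ℤ) ^ (i : ℕ) * (-1) ^ (i : ℕ) = 1 := by rw [← mul_pow]; simp
    linear_combination this

end

section

variable {K : Type*} [Field K] {n : ℕ}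

/-! ### Endpoints below the region of weighted horizontal steps -/

/-- The weight of a path that ends on or below the line `x + y = j - 1` does not depend on `w`. -/
theorem IsLatticePath.pathWeight_eq_of_sum_le {c : Bool} {e : ℤ × ℤ} (X : Fin n → K) (w w' : K)
    {j : ℕ} (he : e.1 + e.2 ≤ (j : ℤ) - 1) :
    ∀ {p : List (ℤ × ℤ)} {s : ℤ × ℤ}, IsLatticePath c s e p →
      pathWeight X w j p = pathWeight X w' j p
  | [], _, h => by simp [IsLatticePath] at h
  | [a], _, _ => by simp [pathWeight]
  | a :: b :: t, s, h => by
    obtain ⟨rfl, h2, h3⟩ := h.cons_cons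
    rw [pathWeight_cons X w j a (b := b) rfl, pathWeight_cons X w' j a (b := b) rfl,
      h3.pathWeight_eq_of_sum_le X w w' he]
    congr 1
    have hne : ¬ (b = a + (1, 0) ∧ (j : ℤ) - 1 ≤ a.1 + a.2) := by
      rintro ⟨rfl, h4⟩
      have := h3.sum_le
      simp at this
      omega
    simp only [stepWeight, hne, if_false]

/-- With the 0-based `j`, the ends lie no higher than the line where weighted steps begin, so no
such step is ever taken. -/
theorem pathCount_eq_of_sum_le {E : ℕ → Finset (ℤ × ℤ)}
    (hE : ∀ j : Fin n, ∀ e ∈ E (j + 1), e.1 + e.2 ≤ j) (X : Fin n → K) (w w' : K)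
    (sgn : PathFamily n E → ℤ) (good : PathFamily n E → Prop) :
    pathCount E X w sgn good = pathCount E X w' sgn good := by
  refine Finset.sum_congr rfl fun F _ => congrArg _ (Finset.prod_congr rfl fun i _ => ?_)
  obtain ⟨e, he, hp⟩ := F.isPath i
  refine hp.pathWeight_eq_of_sum_le X w w' ?_
  have := hE _ e he
  push_cast
  omega

/-! ### Restriction to non-intersecting families -/

variable {E : ℕ → Finset (ℤ × ℤ)}

theorem pathCount_eq_nonIntersectingBelow (X : Fin n → K) (w : K) :
    pathCount E X w sign (fun _ => True) = pathCount E X w sign NonIntersectingBelow :=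
  pathCount_eq_of_imp E X fun _ h => Or.inl (le_of_lt h)

theorem pathCount_eq_nonIntersectingOnBelow (X : Fin n → K) (w : K) :
    pathCount E X w sign (fun _ => True) = pathCount E X w sign NonIntersectingOnBelow :=
  pathCount_eq_of_imp E X fun _ h => Or.inl h

theorem pathCount_eq_nonIntersecting (X : Fin n → K) :
    pathCount E X (1 : K) sign (fun _ => True) = pathCount E X 1 sign NonIntersecting := by
  rw [pathCount_eq_of_imp E X (T := fun _ => True) fun _ _ => Or.inr rfl]
  congr 1
  funext F
  simp [NonIntersectingAt, NonIntersecting]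

theorem pathCount_indexSign {X : Fin n → K} {w : K}
    (h : ∀ F : PathFamily n E, F.NonIntersecting → (-1) ^ (n + 1).choose 2 * F.sign = F.indexSign)
    (C : K) :
    (-1) ^ (n + 1).choose 2 * C * pathCount E X w sign NonIntersecting =
      C * pathCount E X w indexSign NonIntersecting := by
  classical
  rw [mul_comm _ C, mul_assoc, pathCount, pathCount, Finset.mul_sum]
  congr 1
  refine Finset.sum_congr rfl fun F hF => ?_
  rw [← h F (Finset.mem_filter.1 hF).2]
  push_cast
  ring

/-- The restricted forms of an identity for all families, if `w = 1` or if the weights do not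
depend on `w`. -/
theorem identities_of_all {X : Fin n → K} {w R C : K}
    (hR : R = (-1) ^ (n + 1).choose 2 * C * pathCount E X w sign (fun _ => True)) :
    R = (-1) ^ (n + 1).choose 2 * C * pathCount E X w sign (fun _ => True) ∧
    R = (-1) ^ (n + 1).choose 2 * C * pathCount E X w sign NonIntersectingBelow ∧
    R = (-1) ^ (n + 1).choose 2 * C * pathCount E X w sign NonIntersectingOnBelow :=
  ⟨hR, by rw [← pathCount_eq_nonIntersectingBelow, hR],
    by rw [← pathCount_eq_nonIntersectingOnBelow, hR]⟩

/-- `hw` moves the count to w = 1, where exchanges above the line also preserve weights, and then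
back. -/
theorem identities_nonIntersecting {X : Fin n → K} {w R C : K}
    (hw : ∀ good, pathCount E X w sign good = pathCount E X 1 sign good)
    (h : ∀ F : PathFamily n E, F.NonIntersecting → (-1) ^ (n + 1).choose 2 * F.sign = F.indexSign)
    (hR : R = (-1) ^ (n + 1).choose 2 * C * pathCount E X w sign (fun _ => True)) :
    R = (-1) ^ (n + 1).choose 2 * C * pathCount E X w sign NonIntersecting ∧
    R = C * pathCount E X w indexSign NonIntersecting := by
  rw [← pathCount_indexSign h, and_self, hR, hw, pathCount_eq_nonIntersecting, hw]

/-! ### The endpoints -/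

theorem sign_eq_oddEnds (n l : ℕ) (F : PathFamily n (oddEnds n l)) (hF : F.NonIntersecting) :
    (-1) ^ (n + 1).choose 2 * F.sign = F.indexSign := by
  refine hF.sign_eq (fun j e he => ?_) (fun j j' hj e he e' he' => ?_)
  · simp only [oddEnds, Finset.mem_singleton] at he
    subst he
    push_cast; omega
  · have hj : (j' : ℕ) < j := hj
    simp only [oddEnds, Finset.mem_singleton] at he he'
    subst he he'
    push_cast; omega

theorem sign_eq_oddEnds' (n l : ℕ) (F : PathFamily n (oddEnds' n l)) (hF : F.NonIntersecting) :
    (-1) ^ (n + 1).choose 2 * F.sign = F.indexSign := by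
  refine hF.sign_eq (fun j e he => ?_) (fun j j' hj e he e' he' => ?_)
  · simp only [oddEnds', Finset.mem_singleton] at he
    subst he
    push_cast; omega
  · have hj : (j' : ℕ) < j := hj
    simp only [oddEnds', Finset.mem_singleton] at he he'
    subst he he'
    push_cast; omega

theorem sign_eq_evenEnds (n l : ℕ) (F : PathFamily n (evenEnds n l)) (hF : F.NonIntersecting) :
    (-1) ^ (n + 1).choose 2 * F.sign = F.indexSign := by
  refine hF.sign_eq (fun j e he => ?_) (fun j j' hj e he e' he' => ?_)
  · simp only [evenEnds, Finset.mem_insert, Finset.mem_singleton] at he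
    rcases he with rfl | rfl <;> push_cast <;> omega
  · have hj : (j' : ℕ) < j := hj
    simp only [evenEnds, Finset.mem_insert, Finset.mem_singleton] at he he'
    rcases he with rfl | rfl <;> rcases he' with rfl | rfl <;> push_cast <;> omega

theorem sign_eq_evenEnds' (n l : ℕ) (F : PathFamily n (evenEnds' n l)) (hF : F.NonIntersecting) :
    (-1) ^ (n + 1).choose 2 * F.sign = F.indexSign := by
  refine hF.sign_eq (fun j e he => ?_) (fun j j' hj e he e' he' => ?_)
  · simp only [evenEnds', Finset.mem_insert, Finset.mem_singleton] at he
    rcases he with rfl | rfl <;> push_cast <;> omega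
  · have hj : (j' : ℕ) < j := hj
    simp only [evenEnds', Finset.mem_insert, Finset.mem_singleton] at he he'
    rcases he with rfl | rfl <;> rcases he' with rfl | rfl <;> push_cast <;> omega

theorem eval_abovePoly_ends (w x : K) (j : Fin n) :
    (abovePoly w (j + 1) 0 (n - 1)).eval x =
      (1 + x) ^ (j : ℕ) * (1 + w * x) ^ (n - ((j : ℕ) + 1)) := by
  have := j.2
  rw [eval_abovePoly w x (by omega), show n - 1 - (j : ℕ) = n - ((j : ℕ) + 1) by omega]

/-- For w = 0 the factor 1 + wx is trivial, so `j` steps already yield the column polynomial. -/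
theorem eval_abovePoly_ends' (x : K) (j : Fin n) :
    (abovePoly (0 : K) (j + 1) 0 j).eval x =
      (1 + x) ^ (j : ℕ) * (1 + 0 * x) ^ (n - ((j : ℕ) + 1)) := by
  rw [eval_abovePoly 0 x le_rfl]
  simp

end

end LittlewoodPaths

/-! ### The identities for the four systems of endpoints -/

theorem mainTheorem4 {K : Type*} [Field K] (n l : ℕ) (X : Fin n → K) (w : K)
    (hX_zero : ∀ i, X i ≠ 0) (hX_one : ∀ i, X i ≠ 1)
    (hX_ne : ∀ i j, i < j → X i ≠ X j) (hX_mul : ∀ i j, i < j → X i * X j ≠ 1) :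
    -- the case `m = 2 l + 1`
    (
      -- any `w`: all families, or those non-intersecting (on and) below `x + y = 0`
      (boundedRHS (2 * l + 1) X w =
          (-1) ^ (n + 1).choose 2 * oddFactor l X w * pathCount (oddEnds n l) X w sign (fun _ => True) ∧
        boundedRHS (2 * l + 1) X w =
          (-1) ^ (n + 1).choose 2 * oddFactor l X w * pathCount (oddEnds n l) X w sign NonIntersectingBelow ∧
        boundedRHS (2 * l + 1) X w =
          (-1) ^ (n + 1).choose 2 * oddFactor l X w * pathCount (oddEnds n l) X w sign NonIntersectingOnBelow) ∧
      -- `w = 1`: families non-intersecting everywhere, with either form of the sign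
      (w = 1 →
        boundedRHS (2 * l + 1) X w =
          (-1) ^ (n + 1).choose 2 * oddFactor l X w * pathCount (oddEnds n l) X w sign NonIntersecting ∧
        boundedRHS (2 * l + 1) X w =
          oddFactor l X w * pathCount (oddEnds n l) X w indexSign NonIntersecting) ∧
      -- `w = 0`: the same after replacing `E_j` by `E'_j`
      (w = 0 →
        boundedRHS (2 * l + 1) X w =
          (-1) ^ (n + 1).choose 2 * oddFactor l X w * pathCount (oddEnds' n l) X w sign (fun _ => True) ∧
        boundedRHS (2 * l + 1) X w =
          (-1) ^ (n + 1).choose 2 * oddFactor l X w * pathCount (oddEnds' n l) X w sign NonIntersectingBelow ∧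
        boundedRHS (2 * l + 1) X w =
          (-1) ^ (n + 1).choose 2 * oddFactor l X w * pathCount (oddEnds' n l) X w sign NonIntersectingOnBelow ∧
        boundedRHS (2 * l + 1) X w =
          (-1) ^ (n + 1).choose 2 * oddFactor l X w * pathCount (oddEnds' n l) X w sign NonIntersecting ∧
        boundedRHS (2 * l + 1) X w =
          oddFactor l X w * pathCount (oddEnds' n l) X w indexSign NonIntersecting) ∧
      -- the two forms of the sign agree, family by family
      ((∀ F : PathFamily n (oddEnds n l), F.NonIntersecting →
          (-1) ^ (n + 1).choose 2 * F.sign = F.indexSign) ∧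
        (∀ F : PathFamily n (oddEnds' n l), F.NonIntersecting →
          (-1) ^ (n + 1).choose 2 * F.sign = F.indexSign))) ∧
    -- the case `m = 2 l`
    (
      -- any `w`: all families, or those non-intersecting (on and) below `x + y = 0`
      (boundedRHS (2 * l) X w =
          (-1) ^ (n + 1).choose 2 * evenFactor l X w * pathCount (evenEnds n l) X w sign (fun _ => True) ∧
        boundedRHS (2 * l) X w =
          (-1) ^ (n + 1).choose 2 * evenFactor l X w * pathCount (evenEnds n l) X w sign NonIntersectingBelow ∧
        boundedRHS (2 * l) X w =
          (-1) ^ (n + 1).choose 2 * evenFactor l X w * pathCount (evenEnds n l) X w sign NonIntersectingOnBelow) ∧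
      -- `w = 1`: families non-intersecting everywhere, with either form of the sign
      (w = 1 →
        boundedRHS (2 * l) X w =
          (-1) ^ (n + 1).choose 2 * evenFactor l X w * pathCount (evenEnds n l) X w sign NonIntersecting ∧
        boundedRHS (2 * l) X w =
          evenFactor l X w * pathCount (evenEnds n l) X w indexSign NonIntersecting) ∧
      -- `w = 0`: the same after replacing `E_j` by `E'_j`
      (w = 0 →
        boundedRHS (2 * l) X w =
          (-1) ^ (n + 1).choose 2 * evenFactor l X w * pathCount (evenEnds' n l) X w sign (fun _ => True) ∧
        boundedRHS (2 * l) X w =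
          (-1) ^ (n + 1).choose 2 * evenFactor l X w * pathCount (evenEnds' n l) X w sign NonIntersectingBelow ∧
        boundedRHS (2 * l) X w =
          (-1) ^ (n + 1).choose 2 * evenFactor l X w * pathCount (evenEnds' n l) X w sign NonIntersectingOnBelow ∧
        boundedRHS (2 * l) X w =
          (-1) ^ (n + 1).choose 2 * evenFactor l X w * pathCount (evenEnds' n l) X w sign NonIntersecting ∧
        boundedRHS (2 * l) X w =
          evenFactor l X w * pathCount (evenEnds' n l) X w indexSign NonIntersecting) ∧
      -- the two forms of the sign agree, family by family
      ((∀ F : PathFamily n (evenEnds n l), F.NonIntersecting →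
          (-1) ^ (n + 1).choose 2 * F.sign = F.indexSign) ∧
        (∀ F : PathFamily n (evenEnds' n l), F.NonIntersecting →
          (-1) ^ (n + 1).choose 2 * F.sign = F.indexSign))) := by
  have odd : boundedRHS (2 * l + 1) X w = (-1) ^ (n + 1).choose 2 * oddFactor l X w *
      pathCount (oddEnds n l) X w sign (fun _ => True) :=
    -- The second coordinate of E_(j+1); all endpoints lie on x+y = n-1.
    boundedRHS_odd_eq (fun j => ⟨(j : ℤ) - l - 1, n - 1, by
      rw [oddEnds]; congr 2; push_cast; ring, by have := j.2; push_cast; omega,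
      by have := j.2; omega, fun x => eval_abovePoly_ends w x j⟩) hX_zero hX_one hX_ne hX_mul
  have even : boundedRHS (2 * l) X w = (-1) ^ (n + 1).choose 2 * evenFactor l X w *
      pathCount (evenEnds n l) X w sign (fun _ => True) :=
    boundedRHS_even_eq (fun j => ⟨(j : ℤ) - l - 1, n - 1, by
      rw [evenEnds]; push_cast; ring_nf, by have := j.2; push_cast; omega,
      by have := j.2; omega, fun x => eval_abovePoly_ends w x j⟩) hX_zero hX_one hX_ne hX_mul
  refine ⟨⟨identities_of_all odd, ?_, ?_, sign_eq_oddEnds n l, sign_eq_oddEnds' n l⟩,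
    ⟨identities_of_all even, ?_, ?_, sign_eq_evenEnds n l, sign_eq_evenEnds' n l⟩⟩
  · rintro rfl
    exact identities_nonIntersecting (fun _ => rfl) (sign_eq_oddEnds n l) odd
  · rintro rfl
    have odd' : boundedRHS (2 * l + 1) X 0 = (-1) ^ (n + 1).choose 2 * oddFactor l X 0 *
        pathCount (oddEnds' n l) X 0 sign (fun _ => True) :=
      -- The second coordinate of E'_(j+1), which lies on x+y = j.
      boundedRHS_odd_eq (fun j => ⟨2 * (j : ℤ) - n - l, j, by
        rw [oddEnds']; congr 2; push_cast; ring, by push_cast; ring, j.2,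
        fun x => eval_abovePoly_ends' x j⟩) hX_zero hX_one hX_ne hX_mul
    obtain ⟨h1, h2, h3⟩ := identities_of_all odd'
    refine ⟨h1, h2, h3, identities_nonIntersecting (fun good => ?_) (sign_eq_oddEnds' n l) odd'⟩
    refine pathCount_eq_of_sum_le (fun j e he => ?_) X 0 1 _ good
    simp only [oddEnds', Finset.mem_singleton] at he
    subst he
    push_cast; omega
  · rintro rfl
    exact identities_nonIntersecting (fun _ => rfl) (sign_eq_evenEnds n l) even
  · rintro rfl
    have even' : boundedRHS (2 * l) X 0 = (-1) ^ (n + 1).choose 2 * evenFactor l X 0 *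
        pathCount (evenEnds' n l) X 0 sign (fun _ => True) :=
      boundedRHS_even_eq (fun j => ⟨2 * (j : ℤ) - n - l, j, by
        rw [evenEnds']; push_cast; ring_nf, by push_cast; ring, j.2,
        fun x => eval_abovePoly_ends' x j⟩) hX_zero hX_one hX_ne hX_mul
    obtain ⟨h1, h2, h3⟩ := identities_of_all even'
    refine ⟨h1, h2, h3, identities_nonIntersecting (fun good => ?_) (sign_eq_evenEnds' n l) even'⟩
    refine pathCount_eq_of_sum_le (fun j e he => ?_) X 0 1 _ good
    simp only [evenEnds', Finset.mem_insert, Finset.mem_singleton] at he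
    rcases he with rfl | rfl <;> push_cast <;> omega
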